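/- **Setting.** Let $(M,g)$ be a smooth Riemannian manifold with Levi-Civita connection $\nabla$, and let $G$ be a compact Lie group acting smoothly and isometrically (from the left) on $M$. Let $Q$ be a bi-invariant metric on $G$, i.e. an $\mathrm{Ad}(G)$-invariant inner product on the Lie algebra $\mathfrak g$ (with the bracket of left-invariant fields). For $X\in\mathfrak g$ let $X^*$ be the action field, $X^*(p)=\frac{d}{dt}\big|_{0}\exp(tX)p$. For $p\in M$ let $\mathcal V_p=\{X^*(p): X\in\mathfrak g\}$, $\mathcal H_p=\mathcal V_p^{\perp}\subset T_pM$, $\mathfrak g_p=\{X\in\mathfrak g: X^*(p)=0\}$ (the isotropy algebra) and $\mathfrak m_p=\mathfrak g_p^{\perp_Q}$. The orbit tensor $P=P_p:\mathfrak m_p\to\mathfrak m_p$ is defined by $Q(PX,Y)=g(X^*,Y^*)_p$ for $X,Y\in\mathfrak m_p$, and is extended to $\mathfrak g=\mathfrak g_p\oplus\mathfrak m_p$ by $0$ on $\mathfrak g_p$. For $Z\in\mathfrak g$ put $w_Z=g(Z^*,\cdot)$; the exterior derivative is normalised by $2\,dw(U,V)=U(w(V))-V(w(U))-w([U,V])$.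 For $U\in\mathcal H_p$ the shape operator $S_U:\mathcal V_p\to\mathcal V_p$ of the orbit $Gp$ at $p$ is given by $g(S_U(X^*),Y^*)=g(\nabla_{X^*}Y^*,U)$ for $X,Y\in\mathfrak m_p$. Call $p$ regular if the dimension of the orbits is constant near $p$ (this includes all points on principal orbits); at such a point the O'Neill tensor is $A_UV=(\nabla_U\tilde V)^{\mathcal V}$ for $U,V\in\mathcal H_p$, where $\tilde V$ is a smooth horizontal extension of $V$ near $p$ (take the horizontal part of a smooth extension of $V$). **Proposition 1.5.** For every $Z\in\mathfrak g$ and $p\in M$ the following holds at $p$. (a) For $X,Y\in\mathfrak m_p$: $$2\,dw_Z(X^*,Y^*)=Q\big([PX,Y]+[X,PY]-P[X,Y],\,Z\big).$$ (b) For $X\in\mathfrak m_p$ and $U\in\mathcal H_p$: $$2\,dw_Z(X^*,U)=-2\,g(\nabla_{X^*}\tilde U,Z^*)=2\,g(S_U(X^*),Z^*)=-U\big(Q(PX,Z)\big).$$ Here $\tilde U$ is any vector field, smooth near $p$, with $\tilde U(p)=U$, which is normal to the orbit $Gp$ at the points of $Gp$ near $p$; such fields exist. In the last term $Q(PX,Z)$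 is the function $q\mapsto Q(P_qX,Z)$ on $M$. (c) For $U,V\in\mathcal H_p$ and any vector field $\tilde V$, smooth and horizontal near $p$, with $\tilde V(p)=V$: $$dw_Z(U,V)=-g(\nabla_U\tilde V,Z^*).$$ If $p$ is regular, such a field $\tilde V$ exists and $$dw_Z(U,V)=-g(A_UV,Z^*).$$ At an arbitrary point $p$ there is a unique vector $A_UV\in\mathcal V_p$ with $g(A_UV,X^*)=-dw_X(U,V)$ for all $X\in\mathfrak m_p$; this defines the extension of $A$ to all of $M$. -/

import Mathlib

open Bundle FiberBundle VectorField Topology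
open scoped Manifold ContDiff

noncomputable section
namespace Cheeger

section ExteriorDerivative

variable {E : Type*} [NormedAddCommGroup E] [NormedSpace ℝ E] [FiniteDimensional ℝ E]
  {M : Type*} [TopologicalSpace M] [ChartedSpace E M] [IsManifold 𝓘(ℝ, E) ∞ M]
  {U W : Π x : M, TangentSpace 𝓘(ℝ, E) x} {x : M}

/-- Tangent spaces of a finite-dimensional manifold are finite-dimensional. -/
instance instFiniteDimensionalTangentSpace {E : Type*} [NormedAddCommGroup E] [NormedSpace ℝ E]
    [FiniteDimensional ℝ E] {M : Type*} [TopologicalSpace M] [ChartedSpace E M] (x : M) :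
    FiniteDimensional ℝ (TangentSpace 𝓘(ℝ, E) x) :=
  inferInstanceAs (FiniteDimensional ℝ E)

/-- The exterior derivative of a one-form `w`, in the normalisation
`2 dw(U, V) = U (w V) - V (w U) - w [U, V]`. The vectors `u`, `v` at `x` are extended to vector
fields that are smooth near `x` (constant in the trivialization at `x`); by
`two_mul_extDerivOneForm_apply` the choice of the extensions is irrelevant. -/
def extDerivOneForm (w : Π x : M, TangentSpace 𝓘(ℝ, E) x →L[ℝ] ℝ) (x : M)
    (u v : TangentSpace 𝓘(ℝ, E) x) : ℝ :=
  (1 / 2) * (mvfderiv 𝓘(ℝ, E) (fun y => w y (extend E v y)) x u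
    - mvfderiv 𝓘(ℝ, E) (fun y => w y (extend E u y)) x v
    - w x (mlieBracket 𝓘(ℝ, E) (extend E u) (extend E v) x))

/-- The invariant formula for `dw`, valid for all differentiable vector fields. -/
theorem two_mul_extDerivOneForm_apply {w : Π x : M, TangentSpace 𝓘(ℝ, E) x →L[ℝ] ℝ}
    (hw : ∀ V : (Π x : M, TangentSpace 𝓘(ℝ, E) x), MDiffAt (T% V) x →
      MDiffAt (fun y => w y (V y)) x)
    (hU : MDiffAt (T% U) x) (hW : MDiffAt (T% W) x) :
    2 * extDerivOneForm w x (U x) (W x) =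
      mvfderiv 𝓘(ℝ, E) (fun y => w y (W y)) x (U x)
        - mvfderiv 𝓘(ℝ, E) (fun y => w y (U y)) x (W x)
        - w x (mlieBracket 𝓘(ℝ, E) U W x) := by
  let Φ : (Π x : M, TangentSpace 𝓘(ℝ, E) x) → (Π x : M, TangentSpace 𝓘(ℝ, E) x) → ℝ :=
    fun U W => mvfderiv 𝓘(ℝ, E) (fun y => w y (W y)) x (U x)
        - mvfderiv 𝓘(ℝ, E) (fun y => w y (U y)) x (W x)
        - w x (mlieBracket 𝓘(ℝ, E) U W x)
  have h1 : ∀ W, MDiffAt (T% W) x → TensorialAt 𝓘(ℝ, E) E (fun U => Φ U W) x := fun W hW =>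
    { smul := fun {f U} hf hU => by
        have h := mvfderiv_fun_mul hf (hw U hU)
        simp only [Φ, Pi.smul_apply', mlieBracket_smul_left hf hU, map_smul, map_add, smul_eq_mul,
          h, _root_.add_apply, _root_.smul_apply, map_neg, neg_smul]
        ring
      add := fun {U U'} hU hU' => by
        have h := mvfderiv_fun_add (hw U hU) (hw U' hU')
        simp only [Φ, Pi.add_apply, mlieBracket_add_left hU hU', map_add, h, _root_.add_apply]
        ring }
  have h2 : ∀ U, MDiffAt (T% U) x → TensorialAt 𝓘(ℝ, E) E (fun W => Φ U W) x := fun U hU =>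
    { smul := fun {f W} hf hW => by
        have h := mvfderiv_fun_mul hf (hw W hW)
        simp only [Φ, Pi.smul_apply', mlieBracket_smul_right hf hW, map_smul, map_add, smul_eq_mul,
          h, _root_.add_apply, _root_.smul_apply]
        ring
      add := fun {W W'} hW hW' => by
        have h := mvfderiv_fun_add (hw W hW) (hw W' hW')
        simp only [Φ, Pi.add_apply, mlieBracket_add_right hW hW', map_add, h, _root_.add_apply]
        ring }
  have key := TensorialAt.pointwise₂ h1 h2 (mdifferentiableAt_extend 𝓘(ℝ, E) E (U x)) hU
    (mdifferentiableAt_extend 𝓘(ℝ, E) E (W x)) hW (by simp) (by simp)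
  simp only [Φ, extend_apply_self] at key
  rw [extDerivOneForm, ← key]
  ring

end ExteriorDerivative

section LeviCivita
variable {E : Type*} [NormedAddCommGroup E] [NormedSpace ℝ E] [FiniteDimensional ℝ E]
  {M : Type*} [TopologicalSpace M] [ChartedSpace E M] [IsManifold 𝓘(ℝ, E) ∞ M]
  [RiemannianBundle (fun x : M => TangentSpace 𝓘(ℝ, E) x)]
  [IsContMDiffRiemannianBundle 𝓘(ℝ, E) ∞ E (fun x : M => TangentSpace 𝓘(ℝ, E) x)]

/-- The right-hand side of the Koszul formula for `2 g(∇_U S, W)` at `x`. -/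
def koszul (S U W : Π x : M, TangentSpace 𝓘(ℝ, E) x) (x : M) : ℝ :=
  mvfderiv 𝓘(ℝ, E) (fun y => inner ℝ (S y) (W y)) x (U x)
    + mvfderiv 𝓘(ℝ, E) (fun y => inner ℝ (W y) (U y)) x (S x)
    - mvfderiv 𝓘(ℝ, E) (fun y => inner ℝ (U y) (S y)) x (W x)
    + inner ℝ (mlieBracket 𝓘(ℝ, E) U S x) (W x)
    - inner ℝ (mlieBracket 𝓘(ℝ, E) S W x) (U x)
    - inner ℝ (mlieBracket 𝓘(ℝ, E) U W x) (S x)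

variable {S S' U W : Π x : M, TangentSpace 𝓘(ℝ, E) x} {x : M}

theorem mdiffAt_inner (hU : MDiffAt (T% U) x) (hW : MDiffAt (T% W) x) :
    MDiffAt (fun y => (inner ℝ (U y) (W y) : ℝ)) x :=
  MDifferentiableAt.inner_bundle (E := fun x : M => TangentSpace 𝓘(ℝ, E) x) hU hW

theorem koszul_tensorial_left (hS : MDiffAt (T% S) x) (hW : MDiffAt (T% W) x) :
    TensorialAt 𝓘(ℝ, E) E (fun U => koszul S U W x) x where
  smul {f U} hf hU := by
    have h1 := mvfderiv_fun_mul hf (mdiffAt_inner hW hU)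
    have h2 := mvfderiv_fun_mul hf (mdiffAt_inner hU hS)
    simp only [koszul, Pi.smul_apply', inner_smul_left, inner_smul_right, RCLike.conj_to_real,
      mlieBracket_smul_left hf hU, inner_add_left, h1, h2, map_smul, smul_eq_mul, _root_.add_apply,
      _root_.smul_apply, inner_neg_left, neg_smul]
    rw [real_inner_comm (U x) (W x)]
    ring
  add {U U'} hU hU' := by
    have h1 := mvfderiv_fun_add (mdiffAt_inner hW hU) (mdiffAt_inner hW hU')
    have h2 := mvfderiv_fun_add (mdiffAt_inner hU hS) (mdiffAt_inner hU' hS)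
    simp only [koszul, Pi.add_apply, inner_add_left, inner_add_right, 
      mlieBracket_add_left hU hU', h1, h2, map_add, _root_.add_apply]
    ring

theorem koszul_tensorial_right (hS : MDiffAt (T% S) x) (hU : MDiffAt (T% U) x) :
    TensorialAt 𝓘(ℝ, E) E (fun W => koszul S U W x) x where
  smul {f W} hf hW := by
    have h1 := mvfderiv_fun_mul hf (mdiffAt_inner hS hW)
    have h2 := mvfderiv_fun_mul hf (mdiffAt_inner hW hU)
    simp only [koszul, Pi.smul_apply', inner_smul_left, inner_smul_right, RCLike.conj_to_real,
      mlieBracket_smul_right hf hW, inner_add_left, h1, h2, map_smul, smul_eq_mul,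
      _root_.add_apply, _root_.smul_apply]
    rw [real_inner_comm (U x) (W x), real_inner_comm (W x) (S x)]
    ring
  add {W W'} hW hW' := by
    have h1 := mvfderiv_fun_add (mdiffAt_inner hS hW) (mdiffAt_inner hS hW')
    have h2 := mvfderiv_fun_add (mdiffAt_inner hW hU) (mdiffAt_inner hW' hU)
    simp only [koszul, Pi.add_apply, inner_add_left, inner_add_right, 
      mlieBracket_add_right hW hW', h1, h2, map_add, _root_.add_apply]
    ring

theorem koszul_add (hS : MDiffAt (T% S) x) (hS' : MDiffAt (T% S') x) (hU : MDiffAt (T% U) x)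
    (hW : MDiffAt (T% W) x) :
    koszul (S + S') U W x = koszul S U W x + koszul S' U W x := by
  have h1 := mvfderiv_fun_add (mdiffAt_inner hS hW) (mdiffAt_inner hS' hW)
  have h2 := mvfderiv_fun_add (mdiffAt_inner hU hS) (mdiffAt_inner hU hS')
  simp only [koszul, Pi.add_apply, inner_add_left, inner_add_right, 
      mlieBracket_add_right hS hS', mlieBracket_add_left hS hS', h1, h2, map_add, _root_.add_apply]
  ring

theorem koszul_smul {f : M → ℝ} (hf : MDiffAt f x) (hS : MDiffAt (T% S) x) 
    (hU : MDiffAt (T% U) x) (hW : MDiffAt (T% W) x) :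
    koszul (f • S) U W x = f x * koszul S U W x +
      2 * (mvfderiv 𝓘(ℝ, E) f x (U x) * inner ℝ (S x) (W x)) := by
  have h1 := mvfderiv_fun_mul hf (mdiffAt_inner hS hW)
  have h2 := mvfderiv_fun_mul hf (mdiffAt_inner hU hS)
  simp only [koszul, Pi.smul_apply', inner_smul_left, inner_smul_right, RCLike.conj_to_real,
      mlieBracket_smul_right hf hS, mlieBracket_smul_left hf hS, inner_add_left, h1, h2,
      map_smul, smul_eq_mul,
      _root_.add_apply, _root_.smul_apply, inner_neg_left, neg_smul]
  rw [real_inner_comm (S x) (U x)]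
  ring


/-- The vector representing a linear functional on `T_x M` with respect to the metric. -/
def sharp (x : M) : (TangentSpace 𝓘(ℝ, E) x →L[ℝ] ℝ) →ₗ[ℝ] TangentSpace 𝓘(ℝ, E) x :=
  (InnerProductSpace.toDual ℝ (TangentSpace 𝓘(ℝ, E) x)).symm.toLinearEquiv.toLinearMap

open Classical in
/-- The Levi-Civita connection as a bare function: for `S` differentiable at `x`, the value
`leviCivitaAux S x u = ∇_u S` is determined by `2 g(∇_u S, w) = koszul S U W x`, with `U`, `W` any
differentiable extensions of `u`, `w` (see `inner_leviCivita`). -/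
def leviCivitaAux (S : Π x : M, TangentSpace 𝓘(ℝ, E) x) (x : M) :
    TangentSpace 𝓘(ℝ, E) x →L[ℝ] TangentSpace 𝓘(ℝ, E) x :=
  if hS : MDiffAt (T% S) x then
    (1 / 2 : ℝ) • LinearMap.toContinuousLinearMap (sharp x ∘ₗ
      (TensorialAt.mkHom₂ (fun U W => koszul S U W x) x 
        (fun _ hW => koszul_tensorial_left hS hW)
        (fun _ hU => koszul_tensorial_right hS hU)).toLinearMap)
  else 0

theorem inner_leviCivitaAux (hS : MDiffAt (T% S) x) (hU : MDiffAt (T% U) x)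
    (hW : MDiffAt (T% W) x) :
    inner ℝ (leviCivitaAux S x (U x)) (W x) = koszul S U W x / 2 := by
  have key := TensorialAt.mkHom₂_apply (Φ := fun U W => koszul S U W x)
    (fun _ hW => koszul_tensorial_left hS hW) (fun _ hU => koszul_tensorial_right hS hU) hU hW
  rw [leviCivitaAux, dif_pos hS, ← key, sharp]
  simp only [_root_.smul_apply, inner_smul_left, LinearMap.coe_toContinuousLinearMap',
    LinearMap.comp_apply, ContinuousLinearMap.coe_coe, LinearEquiv.coe_coe,
    LinearIsometryEquiv.coe_toLinearEquiv]
  rw [InnerProductSpace.toDual_symm_apply]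
  simp only [RCLike.conj_to_real]
  ring

/-- The Levi-Civita connection: `leviCivita S x u` is `∇_u S` at `x`. -/
def leviCivita : CovariantDerivative 𝓘(ℝ, E) E (fun x : M => TangentSpace 𝓘(ℝ, E) x) where
  toFun := leviCivitaAux
  isCovariantDerivativeOnUniv :=
    { add := fun {S S' x} hS hS' _ => by
        ext1 u
        refine ext_inner_right ℝ fun w => ?_
        have hu := mdifferentiableAt_extend 𝓘(ℝ, E) E u
        have hw := mdifferentiableAt_extend 𝓘(ℝ, E) E w
        have h0 := inner_leviCivitaAux (mdifferentiableAt_add_section hS hS') hu hw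
        have h1 := inner_leviCivitaAux hS hu hw
        have h2 := inner_leviCivitaAux hS' hu hw
        have h3 := koszul_add hS hS' hu hw
        simp only [extend_apply_self] at h0 h1 h2
        rw [_root_.add_apply, inner_add_left, h1, h2]
        refine h0.trans ?_
        rw [h3]; ring
      leibniz := fun {S f x} hS hf _ => by
        ext1 u
        refine ext_inner_right ℝ fun w => ?_
        have hu := mdifferentiableAt_extend 𝓘(ℝ, E) E u
        have hw := mdifferentiableAt_extend 𝓘(ℝ, E) E w
        have h0 := inner_leviCivitaAux (hf.smul_section hS) hu hw
        have h1 := inner_leviCivitaAux hS hu hw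
        have h3 := koszul_smul hf hS hu hw
        simp only [extend_apply_self] at h0 h1 h3
        rw [_root_.add_apply, inner_add_left, _root_.smul_apply, inner_smul_left, h1,
          ContinuousLinearMap.smulRight_apply, inner_smul_left]
        refine h0.trans ?_
        rw [h3]; simp only [RCLike.conj_to_real]; ring }

theorem inner_leviCivita (hS : MDiffAt (T% S) x) (hU : MDiffAt (T% U) x)
    (hW : MDiffAt (T% W) x) :
    inner ℝ (leviCivita S x (U x)) (W x) = koszul S U W x / 2 :=
  inner_leviCivitaAux hS hU hW

/-- The Levi-Civita connection is torsion-free. -/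
theorem leviCivita_torsion :
    (leviCivita : CovariantDerivative 𝓘(ℝ, E) E
      (fun x : M => TangentSpace 𝓘(ℝ, E) x)).torsion = 0 := by
  rw [CovariantDerivative.torsion_eq_zero_iff]
  intro X Y x hX hY
  refine ext_inner_right ℝ fun w => ?_
  have hw := mdifferentiableAt_extend 𝓘(ℝ, E) E w
  have h1 := inner_leviCivita hY hX hw
  have h2 := inner_leviCivita hX hY hw
  simp only [extend_apply_self] at h1 h2
  rw [inner_sub_left, h1, h2, koszul, koszul, mlieBracket_swap_apply (V := Y) (W := X)]
  simp only [extend_apply_self, inner_neg_left, real_inner_comm]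
  ring

/-- The Levi-Civita connection is compatible with the metric. -/
theorem leviCivita_metric {X : Π x : M, TangentSpace 𝓘(ℝ, E) x} {x : M}
    (hX : MDiffAt (T% X) x) (hS : MDiffAt (T% S) x) (hW : MDiffAt (T% W) x) :
    mvfderiv 𝓘(ℝ, E) (fun y => inner ℝ (S y) (W y)) x (X x) =
      inner ℝ (leviCivita S x (X x)) (W x) + inner ℝ (S x) (leviCivita W x (X x)) := by
  rw [real_inner_comm (leviCivita W x (X x)), inner_leviCivita hS hX hW,
    inner_leviCivita hW hX hS, koszul, koszul, mlieBracket_swap_apply (V := S) (W := W)]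
  simp only [inner_neg_left, real_inner_comm]
  ring


end LeviCivita

section Action

variable {E : Type*} [NormedAddCommGroup E] [NormedSpace ℝ E]
  {M : Type*} [TopologicalSpace M] [ChartedSpace E M]
  {F : Type*} [NormedAddCommGroup F] [NormedSpace ℝ F]
  {G : Type*} [TopologicalSpace G] [ChartedSpace F G] [Group G]

/-- The adjoint representation `Ad a`: the differential at `1` of conjugation by `a`. -/
def Ad (a : G) (X : GroupLieAlgebra 𝓘(ℝ, F) G) : GroupLieAlgebra 𝓘(ℝ, F) G :=
  mfderiv 𝓘(ℝ, F) 𝓘(ℝ, F) (fun b : G => a * b * a⁻¹) 1 X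

variable (F G) in
/-- A bi-invariant metric on a Lie group, given on its Lie algebra: an `Ad`-invariant inner
product. -/
structure BiinvariantMetric where
  form : LinearMap.BilinForm ℝ (GroupLieAlgebra 𝓘(ℝ, F) G)
  symm : ∀ X Y, form X Y = form Y X
  pos : ∀ X, X ≠ 0 → 0 < form X X
  ad_invariant : ∀ (a : G) X Y, form (Ad a X) (Ad a Y) = form X Y

variable [MulAction G M]

variable (E F G) in
/-- The linear map `𝔤 → T_p M`, `X ↦ X^*(p)`: the differential at `1` of `a ↦ a • p`. -/
def infinitesimalAction (p : M) : GroupLieAlgebra 𝓘(ℝ, F) G →ₗ[ℝ] TangentSpace 𝓘(ℝ, E) p :=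
  (mfderiv 𝓘(ℝ, F) 𝓘(ℝ, E) (fun a : G => a • p) 1).toLinearMap

variable (E) in
/-- The action field `X^*` on `M` of an element `X` of the Lie algebra. -/
def actionField (X : GroupLieAlgebra 𝓘(ℝ, F) G) (p : M) : TangentSpace 𝓘(ℝ, E) p :=
  infinitesimalAction E F G p X

variable (E F G) in
/-- The isotropy algebra `𝔤_p`: all `X` with `X^*(p) = 0`. -/
def isotropyAlgebra (p : M) : Submodule ℝ (GroupLieAlgebra 𝓘(ℝ, F) G) :=
  LinearMap.ker (infinitesimalAction E F G p)

variable (E F G) in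
/-- The vertical space `𝒱_p`, the tangent space at `p` of the orbit of `p`: all `X^*(p)`. -/
def vertical (p : M) : Submodule ℝ (TangentSpace 𝓘(ℝ, E) p) :=
  LinearMap.range (infinitesimalAction E F G p)

theorem actionField_mem_vertical (X : GroupLieAlgebra 𝓘(ℝ, F) G) (p : M) :
    actionField E X p ∈ vertical E F G p :=
  ⟨X, rfl⟩

variable (E) in
/-- The subspace `𝔪_p`: the `Q`-orthogonal complement of the isotropy algebra. -/
def isotropyComplement (Q : BiinvariantMetric F G) (p : M) :
    Submodule ℝ (GroupLieAlgebra 𝓘(ℝ, F) G) :=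
  Q.form.orthogonal (isotropyAlgebra E F G p)

variable (E F G) in
/-- `p` is a regular point of the action: the dimension of the orbits is constant near `p`.
All points on principal orbits, and all points on exceptional orbits, are such points. -/
def IsRegularPoint (p : M) : Prop :=
  ∀ᶠ q in 𝓝 p, Module.finrank ℝ (vertical E F G q) = Module.finrank ℝ (vertical E F G p)

theorem BiinvariantMetric.isRefl (Q : BiinvariantMetric F G) : Q.form.IsRefl :=
  fun X Y h => by rw [Q.symm, h]

theorem BiinvariantMetric.restrict_nondegenerate (Q : BiinvariantMetric F G)
    (W : Submodule ℝ (GroupLieAlgebra 𝓘(ℝ, F) G)) : (Q.form.restrict W).Nondegenerate := by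
  have key : ∀ X : W, Q.form (X : GroupLieAlgebra 𝓘(ℝ, F) G) X = 0 → X = 0 := by
    intro X hX
    by_contra hne
    exact (Q.pos X (fun h => hne (Subtype.ext h))).ne' hX
  exact ⟨fun X h => key X (h X), fun X h => key X (h X)⟩

variable [FiniteDimensional ℝ F]

theorem isCompl_isotropyComplement (Q : BiinvariantMetric F G) (p : M) :
    IsCompl (isotropyComplement E Q p) (isotropyAlgebra E F G p) :=
  (LinearMap.BilinForm.isCompl_orthogonal_of_restrict_nondegenerate Q.isRefl
    (Q.restrict_nondegenerate _)).symm

/-- The identification `𝔪_p ≃ 𝒱_p`, `X ↦ X^*(p)`. -/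
def complementEquivVertical (Q : BiinvariantMetric F G) (p : M) :
    isotropyComplement E Q p ≃ₗ[ℝ] vertical E F G p :=
  (infinitesimalAction E F G p).kerComplementEquivRange (isCompl_isotropyComplement Q p)

end Action

section Smooth

variable {E : Type*} [NormedAddCommGroup E] [NormedSpace ℝ E]
  {M : Type*} [TopologicalSpace M] [ChartedSpace E M] [IsManifold 𝓘(ℝ, E) ∞ M]
  {F : Type*} [NormedAddCommGroup F] [NormedSpace ℝ F]
  {G : Type*} [TopologicalSpace G] [ChartedSpace F G] [Group G] [LieGroup 𝓘(ℝ, F) ∞ G]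
  [MulAction G M] [ContMDiffSMul 𝓘(ℝ, F) 𝓘(ℝ, E) ∞ G M]

/-- Action fields are smooth. -/
theorem contMDiff_actionField (X : GroupLieAlgebra 𝓘(ℝ, F) G) :
    ContMDiff 𝓘(ℝ, E) 𝓘(ℝ, E).tangent ∞
      (fun p : M => (⟨p, actionField E X p⟩ : TangentBundle 𝓘(ℝ, E) M)) := by
  let F₁ : M → (TangentBundle 𝓘(ℝ, F) G × TangentBundle 𝓘(ℝ, E) M) :=
    fun p => (TotalSpace.mk' F 1 X, TotalSpace.mk' E p 0)
  have S₁ : ContMDiff 𝓘(ℝ, E) (𝓘(ℝ, F).tangent.prod 𝓘(ℝ, E).tangent) ∞ F₁ :=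
    contMDiff_const.prodMk (contMDiff_zeroSection ℝ (fun x : M => TangentSpace 𝓘(ℝ, E) x))
  have S₂ : ContMDiff (𝓘(ℝ, F).tangent.prod 𝓘(ℝ, E).tangent)
      (𝓘(ℝ, F).prod 𝓘(ℝ, E)).tangent ∞ (equivTangentBundleProd 𝓘(ℝ, F) G 𝓘(ℝ, E) M).symm :=
    contMDiff_equivTangentBundleProd_symm
  have sm : ContMDiff (𝓘(ℝ, F).prod 𝓘(ℝ, E)) 𝓘(ℝ, E) ∞ (fun p : G × M => p.1 • p.2) :=
    ContMDiffSMul.contMDiff_smul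
  have S₃ : ContMDiff (𝓘(ℝ, F).prod 𝓘(ℝ, E)).tangent 𝓘(ℝ, E).tangent ∞
      (tangentMap (𝓘(ℝ, F).prod 𝓘(ℝ, E)) 𝓘(ℝ, E) (fun p : G × M => p.1 • p.2)) :=
    ContMDiff.contMDiff_tangentMap sm (m := ∞) le_rfl
  have S := (S₃.comp S₂).comp S₁
  convert! S with p
  · simp [F₁]
  · simp only [Function.comp_apply, tangentMap, F₁]
    rw [mfderiv_prod_eq_add_apply (sm.mdifferentiableAt (by simp))]
    exact ((congrArg₂ (· + ·) rfl (map_zero _)).trans (add_zero _)).symm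

theorem mdiffAt_actionField (X : GroupLieAlgebra 𝓘(ℝ, F) G) (p : M) :
    MDiffAt (T% (fun q : M => actionField E X q)) p :=
  (contMDiff_actionField X).mdifferentiableAt (by simp)


end Smooth

section Riemannian

variable {E : Type*} [NormedAddCommGroup E] [NormedSpace ℝ E] [FiniteDimensional ℝ E]
  {M : Type*} [TopologicalSpace M] [ChartedSpace E M]
  [RiemannianBundle (fun x : M => TangentSpace 𝓘(ℝ, E) x)]
  {F : Type*} [NormedAddCommGroup F] [NormedSpace ℝ F] [FiniteDimensional ℝ F]
  {G : Type*} [TopologicalSpace G] [ChartedSpace F G] [Group G] [MulAction G M]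

variable (E M G) in
/-- `G` acts by isometries: all differentials `T_p M → T_{ap} M` preserve the inner products. -/
def IsIsometricAction : Prop :=
  ∀ (a : G) (p : M) (u v : TangentSpace 𝓘(ℝ, E) p),
    (inner ℝ (mfderiv 𝓘(ℝ, E) 𝓘(ℝ, E) (fun q : M => a • q) p u)
      (mfderiv 𝓘(ℝ, E) 𝓘(ℝ, E) (fun q : M => a • q) p v) : ℝ) = inner ℝ u v

variable (E F G) in
/-- The horizontal space `ℋ_p`: the orthogonal complement of the vertical space. -/
def horizontal (p : M) : Submodule ℝ (TangentSpace 𝓘(ℝ, E) p) := (vertical E F G p)ᗮ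

variable (E M) in
/-- The one-form `w_Z = g(Z^*, ·)`. -/
def dualForm (Z : GroupLieAlgebra 𝓘(ℝ, F) G) (p : M) : TangentSpace 𝓘(ℝ, E) p →L[ℝ] ℝ :=
  innerSL ℝ (actionField E Z p)

variable (E) in
/-- The orbit tensor `P : 𝔪_p → 𝔪_p`, given by `Q(P X, Y) = g(X^*, Y^*)_p` for `X, Y ∈ 𝔪_p`. -/
def orbitTensor (Q : BiinvariantMetric F G) (p : M) : isotropyComplement E Q p →ₗ[ℝ] isotropyComplement E Q p :=
  ((Q.form.restrict _).toDual (Q.restrict_nondegenerate (isotropyComplement E Q p))).symm.toLinearMap ∘ₗ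
    (innerₗ (TangentSpace 𝓘(ℝ, E) p)).compl₁₂
      (infinitesimalAction E F G p ∘ₗ (isotropyComplement E Q p).subtype)
      (infinitesimalAction E F G p ∘ₗ (isotropyComplement E Q p).subtype)

theorem orbitTensor_spec (Q : BiinvariantMetric F G) (p : M) (X Y : isotropyComplement E Q p) :
    Q.form (orbitTensor E Q p X) Y =
      inner ℝ (actionField E (X : GroupLieAlgebra 𝓘(ℝ, F) G) p)
        (actionField E (Y : GroupLieAlgebra 𝓘(ℝ, F) G) p) :=
  LinearMap.BilinForm.apply_toDual_symm_apply (B := Q.form.restrict (isotropyComplement E Q p))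
    (hB := Q.restrict_nondegenerate _) _ _

variable (E) in
/-- The orbit tensor, extended to all of `𝔤 = 𝔤_p ⊕ 𝔪_p` by zero on `𝔤_p`. -/
def orbitTensorExt (Q : BiinvariantMetric F G) (p : M) :
    GroupLieAlgebra 𝓘(ℝ, F) G →ₗ[ℝ] GroupLieAlgebra 𝓘(ℝ, F) G :=
  (isotropyComplement E Q p).subtype ∘ₗ orbitTensor E Q p ∘ₗ
    (isotropyComplement E Q p).projectionOnto (isotropyAlgebra E F G p) (isCompl_isotropyComplement Q p)

theorem orbitTensorExt_coe (Q : BiinvariantMetric F G) (p : M) (X : isotropyComplement E Q p) :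
    orbitTensorExt E Q p X.1 = orbitTensor E Q p X := by
  simp [orbitTensorExt]

variable [IsManifold 𝓘(ℝ, E) ∞ M]

variable (F G) in
/-- `V` is a vector field, smooth near `p`, that extends the vector `v` at `p` and is normal to the
orbit of `p` at all points of this orbit near `p`. -/
def IsNormalExtension (p : M) (v : TangentSpace 𝓘(ℝ, E) p)
    (V : Π q : M, TangentSpace 𝓘(ℝ, E) q) : Prop :=
  ContMDiffAt 𝓘(ℝ, E) 𝓘(ℝ, E).tangent ∞ (fun q => (⟨q, V q⟩ : TangentBundle 𝓘(ℝ, E) M)) p ∧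
    V p = v ∧ ∀ᶠ q in 𝓝[MulAction.orbit G p] p, V q ∈ horizontal E F G q

variable (F G) in
/-- `V` is a vector field, smooth near `p`, that extends the vector `v` at `p` and is horizontal
near `p`. -/
def IsHorizontalExtension (p : M) (v : TangentSpace 𝓘(ℝ, E) p)
    (V : Π q : M, TangentSpace 𝓘(ℝ, E) q) : Prop :=
  ContMDiffAt 𝓘(ℝ, E) 𝓘(ℝ, E).tangent ∞ (fun q => (⟨q, V q⟩ : TangentBundle 𝓘(ℝ, E) M)) p ∧
    V p = v ∧ ∀ᶠ q in 𝓝 p, V q ∈ horizontal E F G q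

variable [IsContMDiffRiemannianBundle 𝓘(ℝ, E) ∞ E (fun x : M => TangentSpace 𝓘(ℝ, E) x)]

variable (F G) in
/-- The O'Neill tensor `A_u v = (∇_u V)^𝒱` for horizontal `u`, `v` at `p`, where `V` is the
horizontal part of a smooth extension of `v`. It is meaningful at regular points, where this `V` is
a smooth horizontal vector field near `p`. -/
def oneillTensor (p : M) (u v : TangentSpace 𝓘(ℝ, E) p) : TangentSpace 𝓘(ℝ, E) p :=
  (vertical E F G p).starProjection
    (leviCivita (fun q => (horizontal E F G q).starProjection (extend E v q)) p u)

variable [LieGroup 𝓘(ℝ, F) ∞ G] [ContMDiffSMul 𝓘(ℝ, F) 𝓘(ℝ, E) ∞ G M]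

/-- The bilinear form `(v, Y^*) ↦ g(∇_v Y^*, U)` on the vertical space, where `Y ∈ 𝔪_p`. -/
def shapeForm (Q : BiinvariantMetric F G) (p : M) (U : TangentSpace 𝓘(ℝ, E) p) :
    vertical E F G p →ₗ[ℝ] vertical E F G p →ₗ[ℝ] ℝ :=
  LinearMap.mk₂ ℝ
    (fun v w => inner ℝ (leviCivita (fun q : M =>
      actionField E ((complementEquivVertical Q p).symm w : GroupLieAlgebra 𝓘(ℝ, F) G) q) p v) U)
    (fun v v' w => by simp [inner_add_left])
    (fun c v w => by simp [inner_smul_left])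
    (fun v w w' => by
      have h : (fun q : M => actionField E
          ((complementEquivVertical Q p).symm (w + w') : GroupLieAlgebra 𝓘(ℝ, F) G) q) =
          (fun q => actionField E
            ((complementEquivVertical Q p).symm w : GroupLieAlgebra 𝓘(ℝ, F) G) q) +
          (fun q => actionField E
            ((complementEquivVertical Q p).symm w' : GroupLieAlgebra 𝓘(ℝ, F) G) q) := by
        funext q
        simp [actionField]
      rw [h, leviCivita.isCovariantDerivativeOnUniv.add (mdiffAt_actionField _ p)
        (mdiffAt_actionField _ p), _root_.add_apply, inner_add_left])
    (fun c v w => by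
      have h : (fun q : M => actionField E
          ((complementEquivVertical Q p).symm (c • w) : GroupLieAlgebra 𝓘(ℝ, F) G) q) =
          c • (fun q => actionField E
            ((complementEquivVertical Q p).symm w : GroupLieAlgebra 𝓘(ℝ, F) G) q) := by
        funext q
        simp [actionField]
      rw [h, leviCivita.isCovariantDerivativeOnUniv.smul_const c (mdiffAt_actionField _ p),
        _root_.smul_apply, inner_smul_left, RCLike.conj_to_real, smul_eq_mul])

/-- The shape operator `S_U : 𝒱_p → 𝒱_p` of the orbit of `p` in the direction of a normal vector
`U` at `p`: `g(S_U X^*, Y^*) = g(∇_{X^*} Y^*, U)` for `X, Y ∈ 𝔪_p`. -/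
def shapeOperator (Q : BiinvariantMetric F G) (p : M) (U : TangentSpace 𝓘(ℝ, E) p) :
    vertical E F G p →ₗ[ℝ] vertical E F G p :=
  (InnerProductSpace.toDual ℝ (vertical E F G p)).symm.toLinearEquiv.toLinearMap ∘ₗ
    LinearMap.toContinuousLinearMap.toLinearMap ∘ₗ shapeForm Q p U

theorem inner_shapeOperator (Q : BiinvariantMetric F G) (p : M) (U : TangentSpace 𝓘(ℝ, E) p)
    (X Y : isotropyComplement E Q p) :
    (inner ℝ (shapeOperator Q p U ⟨actionField E X.1 p, actionField_mem_vertical X.1 p⟩ :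
      TangentSpace 𝓘(ℝ, E) p) (actionField E Y.1 p) : ℝ) =
      inner ℝ (leviCivita (fun q : M => actionField E Y.1 q) p (actionField E X.1 p)) U := by
  have hY : (complementEquivVertical Q p).symm
      ⟨actionField E Y.1 p, actionField_mem_vertical Y.1 p⟩ = Y := by
    rw [LinearEquiv.symm_apply_eq]
    rfl
  have h : ∀ v w : vertical E F G p,
      (inner ℝ (shapeOperator Q p U v) w : ℝ) = shapeForm Q p U v w := fun v w =>
    InnerProductSpace.toDual_symm_apply (𝕜 := ℝ) (E := vertical E F G p) (x := w)
      (y := LinearMap.toContinuousLinearMap (shapeForm Q p U v))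
  refine (h ⟨actionField E X.1 p, actionField_mem_vertical X.1 p⟩
    ⟨actionField E Y.1 p, actionField_mem_vertical Y.1 p⟩).trans ?_
  rw [shapeForm, LinearMap.mk₂_apply, hY]

end Riemannian

end Cheeger

end

open Cheeger

noncomputable section
namespace Cheeger

/-! Everything rests on one identity: for isometric actions `Z^*` is a Killing field, so `∇Z^*` is
skew and `dw_Z(u, v) = g(∇_u Z^*, v)` in the chosen normalisation (`extDerivOneForm_dualForm`). The
mixed and horizontal formulas then come from metric compatibility. If `V` is orthogonal to `Z^*`
along a curve with velocity `u`, differentiating `g(Z^*, V) = 0` trades `g(∇_u Z^*, V)` for `-g(∇_u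
V, Z^*)`. The shape operator enters because `[X^*, Z^*]` is vertical, which makes `g(∇_{X^*} Z^*,
U)` symmetric in `X` and `Z` for horizontal `U`. With the Killing equation this also gives the
derivative of `g(X^*, Z^*)` in the direction `U`.

For two vertical vectors the action fields themselves serve as extensions. Invariance of the metric
along `X^*` (`mvfderiv_inner_actionField`), the sign rule `[X^*, Y^*] = -[X, Y]^*`
(`mlieBracket_actionField`) and skewness of `ad` for `Q` (`BiinvariantMetric.form_lie`) reduce the
claim to algebra. All three are derivatives at `t = 0` along a curve `c` through `1` in `G`, and
they share one input: the Lie bracket is the derivative of pullbacks (`hasDerivAt_mpullback`). Since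
only the velocity of `c` at `0` matters, no exponential map is used.

Normal and horizontal extensions are built by Gram–Schmidt against the action fields of a basis of
`𝔪_p`. These fields stay independent near `p`, and they span the vertical space wherever the orbit
dimension is that of `p`: along the orbit of `p` always, and on a neighbourhood if `p` is regular.
-/

set_option synthInstance.maxHeartbeats 200000 in
theorem hasFDerivAt_ringInverse_one {R : Type*} [NormedRing R] [HasSummableGeomSeries R]
    [NormedAlgebra ℝ R] :
    HasFDerivAt (Ring.inverse : R → R) (-ContinuousLinearMap.id ℝ R) 1 := by
  refine (hasFDerivAt_ringInverse (𝕜 := ℝ) (1 : Rˣ)).congr_fderiv ?_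
  ext A
  simp

/-- The Lie derivative of a vector field along a local one-parameter family of maps of a normed
space, starting at the identity. -/
theorem hasDerivAt_inverse_fderiv_apply {E : Type*} [NormedAddCommGroup E] [NormedSpace ℝ E]
    [CompleteSpace E] {Φ : ℝ × E → E} {y : E} {V : E → E} (hΦ : ContDiffAt ℝ 2 Φ (0, y))
    (h0 : ∀ᶠ z in 𝓝 y, Φ (0, z) = z) (hV : DifferentiableAt ℝ V y) :
    HasDerivAt (fun t : ℝ => (fderiv ℝ (fun z => Φ (t, z)) y).inverse (V (Φ (t, y))))
      (lieBracket ℝ (fun z => deriv (fun t : ℝ => Φ (t, z)) 0) V y) 0 := by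
  have hd : ∀ᶠ x in 𝓝 ((0 : ℝ), y), DifferentiableAt ℝ Φ x :=
    (hΦ.eventually (by simp)).mono fun x hx => hx.differentiableAt (by simp)
  have hT : HasFDerivAt (fderiv ℝ Φ) (fderiv ℝ (fderiv ℝ Φ) (0, y)) (0, y) :=
    ((hΦ.fderiv_right (m := 1) le_rfl).differentiableAt (by simp)).hasFDerivAt
  set T' := fderiv ℝ (fderiv ℝ Φ) (0, y) with hT'
  -- Mixed partials commute, so the `t`-derivative of the spatial differentials is the spatial
  -- differential of the velocity field.
  have hsymm : ∀ v w, T' v w = T' w v := fun v w =>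
    (hΦ.isSymmSndFDerivAt (by simp)) v w
  have hc : HasDerivAt (fun t : ℝ => (t, y)) ((1 : ℝ), (0 : E)) 0 :=
    (hasDerivAt_id (0 : ℝ)).prodMk (hasDerivAt_const _ _)
  have hi : HasFDerivAt (fun z : E => ((0 : ℝ), z)) (ContinuousLinearMap.inr ℝ ℝ E) y :=
    hasFDerivAt_prodMk_right _ _
  have e1 : ∀ᶠ t : ℝ in 𝓝 0, fderiv ℝ (fun z => Φ (t, z)) y =
      (fderiv ℝ Φ (t, y)).comp (ContinuousLinearMap.inr ℝ ℝ E) := by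
    filter_upwards [hc.continuousAt.eventually hd] with t ht
    exact (ht.hasFDerivAt.comp y (hasFDerivAt_prodMk_right t y)).fderiv
  have e2 : ∀ᶠ z in 𝓝 y, deriv (fun t : ℝ => Φ (t, z)) 0 = fderiv ℝ Φ (0, z) (1, 0) := by
    filter_upwards [hi.continuousAt.eventually hd] with z hz
    exact (hz.hasFDerivAt.comp_hasDerivAt (0 : ℝ)
      ((hasDerivAt_id (0 : ℝ)).prodMk (hasDerivAt_const _ z))).deriv
  have hid : (fderiv ℝ Φ (0, y)).comp (ContinuousLinearMap.inr ℝ ℝ E) =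
      ContinuousLinearMap.id ℝ E := by
    rw [← e1.self_of_nhds]
    refine (hasFDerivAt_id y |>.congr_of_eventuallyEq ?_).fderiv
    filter_upwards [h0] with z hz using hz
  have hA : HasDerivAt (fun t : ℝ => (fderiv ℝ Φ (t, y)).comp (ContinuousLinearMap.inr ℝ ℝ E))
      ((T' (1, 0)).comp (ContinuousLinearMap.inr ℝ ℝ E)) 0 := by
    have h1 : HasDerivAt (fun t : ℝ => fderiv ℝ Φ (t, y)) (T' (1, 0)) 0 :=
      hT.comp_hasDerivAt (0 : ℝ) hc
    simpa using h1.clm_comp (hasDerivAt_const (0 : ℝ) (ContinuousLinearMap.inr ℝ ℝ E))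
  -- Inversion has derivative `-id` at the identity; this produces the negative term of the bracket.
  have hinv : HasFDerivAt (ContinuousLinearMap.inverse : (E →L[ℝ] E) → (E →L[ℝ] E))
      (-ContinuousLinearMap.id ℝ (E →L[ℝ] E)) (ContinuousLinearMap.id ℝ E) := by
    rw [← ContinuousLinearMap.ringInverse_eq_inverse]
    exact hasFDerivAt_ringInverse_one
  have hAi := hinv.comp_hasDerivAt_of_eq (0 : ℝ) hA hid.symm
  have hP : HasDerivAt (fun t : ℝ => Φ (t, y)) (fderiv ℝ Φ (0, y) (1, 0)) 0 :=
    hd.self_of_nhds.hasFDerivAt.comp_hasDerivAt (0 : ℝ) hc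
  have hVP : HasDerivAt (fun t : ℝ => V (Φ (t, y))) (fderiv ℝ V y (fderiv ℝ Φ (0, y) (1, 0))) 0 :=
    hV.hasFDerivAt.comp_hasDerivAt_of_eq (0 : ℝ) hP h0.self_of_nhds.symm
  have hX : HasFDerivAt (fun z => deriv (fun t : ℝ => Φ (t, z)) 0)
      ((ContinuousLinearMap.apply ℝ E ((1 : ℝ), (0 : E))).comp
        (T'.comp (ContinuousLinearMap.inr ℝ ℝ E))) y :=
    ((ContinuousLinearMap.apply ℝ E ((1 : ℝ), (0 : E))).hasFDerivAt.comp y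
      (hT.comp y hi)).congr_of_eventuallyEq e2
  refine ((hAi.clm_apply hVP).congr_of_eventuallyEq ?_).congr_deriv ?_
  · filter_upwards [e1] with t ht
    simp [ht]
  · rw [lieBracket, hX.fderiv, e2.self_of_nhds]
    simp [hid, h0.self_of_nhds, hsymm (1, 0)]
    abel


/-! ### The Lie bracket as a derivative of pullbacks, on manifolds. -/

section LieDerivative

variable {E : Type*} [NormedAddCommGroup E] [NormedSpace ℝ E]
  {M : Type*} [TopologicalSpace M] [ChartedSpace E M] [IsManifold 𝓘(ℝ, E) ∞ M]

theorem mpullbackWithin_extChartAt_symm_apply (V : Π q : M, TangentSpace 𝓘(ℝ, E) q) {p q : M}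
    (hq : q ∈ (extChartAt 𝓘(ℝ, E) p).source) :
    (mpullbackWithin 𝓘(ℝ, E) 𝓘(ℝ, E) (extChartAt 𝓘(ℝ, E) p).symm V (Set.range 𝓘(ℝ, E))
      (extChartAt 𝓘(ℝ, E) p q) : E) =
      mfderiv 𝓘(ℝ, E) 𝓘(ℝ, E) (extChartAt 𝓘(ℝ, E) p) q (V q) := by
  have hy := (extChartAt 𝓘(ℝ, E) p).map_source hq
  -- Going to the chart and back returns `q` only propositionally, and the tangent space depends on
  -- the point; hence the transport along an equality.
  have aux : ∀ q', q' = q → (mfderiv 𝓘(ℝ, E) 𝓘(ℝ, E) (extChartAt 𝓘(ℝ, E) p) q' (V q') : E) =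
      mfderiv 𝓘(ℝ, E) 𝓘(ℝ, E) (extChartAt 𝓘(ℝ, E) p) q (V q) := by
    rintro q' rfl; rfl
  rw [← aux _ ((extChartAt 𝓘(ℝ, E) p).left_inv hq), mpullbackWithin_apply,
    ContinuousLinearMap.inverse_eq
      (mfderivWithin_extChartAt_symm_comp_mfderiv_extChartAt hy)
      (mfderiv_extChartAt_comp_mfderivWithin_extChartAt_symm hy)]
  rfl

/-- The tangent space at `p` is identified with the model space by the preferred chart at `p`, so
that chart has identity differential there. -/
theorem hasMFDerivAt_extChartAt_symm_self (p : M) :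
    HasMFDerivAt 𝓘(ℝ, E) 𝓘(ℝ, E) (extChartAt 𝓘(ℝ, E) p).symm (extChartAt 𝓘(ℝ, E) p p)
      (ContinuousLinearMap.id ℝ E) := by
  have h := (mdifferentiableWithinAt_extChartAt_symm (I := 𝓘(ℝ, E))
    (mem_extChartAt_target (I := 𝓘(ℝ, E)) p)).hasMFDerivWithinAt
  rw [mfderivWithin_range_extChartAt_symm] at h
  exact hasMFDerivWithinAt_univ.1 (by simpa using! h)

/-- The Lie bracket `[X, V]` is the derivative at `t = 0` of the pullbacks of `V` under a local
one-parameter family of maps that starts at the identity and has initial velocity field `X`. -/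
theorem hasDerivAt_mpullback [CompleteSpace E] {Φ : ℝ → M → M} {p : M}
    {X V : Π q : M, TangentSpace 𝓘(ℝ, E) q}
    (hΦ : ContMDiffAt (𝓘(ℝ, ℝ).prod 𝓘(ℝ, E)) 𝓘(ℝ, E) ∞ (fun x : ℝ × M => Φ x.1 x.2) (0, p))
    (h0 : ∀ q, Φ 0 q = q)
    (hX : ∀ q, (mfderiv 𝓘(ℝ, ℝ) 𝓘(ℝ, E) (fun t => Φ t q) 0 (1 : ℝ) : E) = X q)
    (hV : MDiffAt (T% V) p) :
    HasDerivAt (F := E) (fun t => mpullback 𝓘(ℝ, E) 𝓘(ℝ, E) (Φ t) V p)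
      (mlieBracket 𝓘(ℝ, E) X V p) 0 := by
  set φ := extChartAt 𝓘(ℝ, E) p with hφ
  have hp : φ p ∈ φ.target := mem_extChartAt_target p
  have hl : φ.symm (φ p) = p := extChartAt_to_inv p
  have htgt : φ.target ∈ 𝓝 (φ p) := extChartAt_target_mem_nhds p
  have hsrc : φ.source ∈ 𝓝 p := extChartAt_source_mem_nhds p
  let Xc : E → E := mpullbackWithin 𝓘(ℝ, E) 𝓘(ℝ, E) φ.symm X (Set.range 𝓘(ℝ, E))
  let Vc : E → E := mpullbackWithin 𝓘(ℝ, E) 𝓘(ℝ, E) φ.symm V (Set.range 𝓘(ℝ, E))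
  let Φc : ℝ × E → E := fun x => φ (Φ x.1 (φ.symm x.2))
  have hΦ1 : ∀ᶠ x in 𝓝 ((0 : ℝ), p), MDifferentiableAt (𝓘(ℝ, ℝ).prod 𝓘(ℝ, E)) 𝓘(ℝ, E)
      (fun x : ℝ × M => Φ x.1 x.2) x := by
    have h1 : ContMDiffAt (𝓘(ℝ, ℝ).prod 𝓘(ℝ, E)) 𝓘(ℝ, E) 1 (fun x : ℝ × M => Φ x.1 x.2) (0, p) :=
      hΦ.of_le (by simp)
    exact ((contMDiffAt_iff_contMDiffAt_nhds (by simp)).1 h1).mono fun x hx =>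
      hx.mdifferentiableAt (by simp)
  have hcont : ContinuousAt (fun x : ℝ × M => Φ x.1 x.2) (0, p) := hΦ.continuousAt
  have hsymm : ContinuousAt φ.symm (φ p) := continuousAt_extChartAt_symm p
  have ct : ContinuousAt (fun t : ℝ => (t, p)) 0 := by fun_prop
  have hΦc : ContDiffAt ℝ ∞ Φc (0, φ p) := by
    have h1 : ContMDiffAt 𝓘(ℝ, E) 𝓘(ℝ, E) ∞ φ.symm (φ p) :=
      (contMDiffOn_extChartAt_symm p).contMDiffAt htgt
    have h2 : ContMDiffAt 𝓘(ℝ, ℝ × E) (𝓘(ℝ, ℝ).prod 𝓘(ℝ, E)) ∞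
        (fun x : ℝ × E => (x.1, φ.symm x.2)) (0, φ p) :=
      contDiff_fst.contMDiff.contMDiffAt.prodMk
        (ContMDiffAt.comp (0, φ p) (f := Prod.snd) h1 contDiff_snd.contMDiff.contMDiffAt)
    have h3 : ContMDiffAt 𝓘(ℝ, ℝ × E) 𝓘(ℝ, E) ∞ (fun x : ℝ × E => Φ x.1 (φ.symm x.2)) (0, φ p) :=
      hΦ.comp_of_eq (f := fun x : ℝ × E => (x.1, φ.symm x.2)) h2 (by simp [hl])
    have h4 : ContMDiffAt 𝓘(ℝ, E) 𝓘(ℝ, E) ∞ φ p := contMDiffAt_extChartAt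
    exact (h4.comp_of_eq h3 (by simp [hl, h0])).contDiffAt
  have hΦ0 : ∀ᶠ z in 𝓝 (φ p), Φc (0, z) = z := by
    filter_upwards [htgt] with z hz
    simp [Φc, h0, φ.right_inv hz]
  have hVc : DifferentiableAt ℝ Vc (φ p) := by
    have := hV.mdifferentiableWithinAt (s := Set.univ)
    have h2 := this.differentiableWithinAt_mpullbackWithin_vectorField
    have hr : (extChartAt 𝓘(ℝ, E) p).symm ⁻¹' Set.univ ∩ Set.range 𝓘(ℝ, E) = Set.univ := by simp
    rw [hr] at h2
    exact (differentiableWithinAt_univ (f := Vc)).1 h2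
  have hΦc2 : ContDiffAt ℝ 2 Φc (0, φ p) := hΦc.of_le ENat.LEInfty.out
  have key := hasDerivAt_inverse_fderiv_apply hΦc2 hΦ0 hVc
  have eX : (fun z => deriv (fun t : ℝ => Φc (t, z)) 0) =ᶠ[𝓝 (φ p)] Xc := by
    have c2 : Filter.Tendsto (fun z : E => ((0 : ℝ), φ.symm z)) (𝓝 (φ p)) (𝓝 ((0 : ℝ), p)) := by
      have := (continuousAt_const (y := (0 : ℝ))).prodMk hsymm
      simpa [ContinuousAt, hl] using! this
    filter_upwards [htgt, c2.eventually hΦ1] with z hz hz1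
    have hz' := φ.map_target hz
    have e : Xc (φ (φ.symm z)) = _ := mpullbackWithin_extChartAt_symm_apply X hz'
    rw [φ.right_inv hz] at e
    rw [e, ← hX]
    have d1 : MDifferentiableAt 𝓘(ℝ, ℝ) 𝓘(ℝ, E) (fun t => Φ t (φ.symm z)) 0 :=
      hz1.comp (0 : ℝ) (mdifferentiableAt_id.prodMk mdifferentiableAt_const)
    have d2 : MDifferentiableAt 𝓘(ℝ, E) 𝓘(ℝ, E) φ (φ.symm z) :=
      mdifferentiableAt_extChartAt (by simpa [hφ] using hz')
    have d3 := mfderiv_comp_apply_of_eq (x := (0 : ℝ)) d2 d1 (h0 _) (1 : ℝ)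
    rw [mfderiv_eq_fderiv] at d3
    exact d3
  -- The chart differential at `Φ t p` occurs both in the coordinate field and in the differential
  -- of `Φc`, and cancels. The one at `p` is the identity, so the coordinate expression equals the
  -- intrinsic pullback.
  have eV : (fun t : ℝ => (fderiv ℝ (fun z => Φc (t, z)) (φ p)).inverse (Vc (Φc (t, φ p))))
      =ᶠ[𝓝 0] fun t => (mpullback 𝓘(ℝ, E) 𝓘(ℝ, E) (Φ t) V p : E) := by
    have c3 : Filter.Tendsto (fun t : ℝ => Φ t p) (𝓝 0) (𝓝 p) := by
      have : ContinuousAt (fun t : ℝ => Φ t p) 0 := hcont.comp (f := fun t : ℝ => (t, p)) ct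
      simpa [ContinuousAt, h0] using this
    filter_upwards [ct.eventually hΦ1, c3.eventually hsrc] with t ht1 ht2
    have ht2' : Φ t p ∈ (chartAt E p).source := by
      have : Φ t p ∈ φ.source := ht2
      simpa [hφ] using this
    have d1 : HasMFDerivAt 𝓘(ℝ, E) 𝓘(ℝ, E) (Φ t) p (mfderiv 𝓘(ℝ, E) 𝓘(ℝ, E) (Φ t) p) :=
      (ht1.comp p (mdifferentiableAt_const.prodMk mdifferentiableAt_id)).hasMFDerivAt
    have d2 : HasMFDerivAt 𝓘(ℝ, E) 𝓘(ℝ, E) φ (Φ t p) (mfderiv 𝓘(ℝ, E) 𝓘(ℝ, E) φ (Φ t p)) :=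
      (mdifferentiableAt_extChartAt ht2').hasMFDerivAt
    have d3 := hasMFDerivAt_extChartAt_symm_self (E := E) p
    have d4 : (fderiv ℝ (fun z => Φc (t, z)) (φ p) : E →L[ℝ] E) =
        (mfderiv 𝓘(ℝ, E) 𝓘(ℝ, E) φ (Φ t p)).comp (mfderiv 𝓘(ℝ, E) 𝓘(ℝ, E) (Φ t) p) := by
      ext v
      have d5 := mfderiv_comp_apply_of_eq (x := φ p) (d2.comp p d1).mdifferentiableAt
        d3.mdifferentiableAt hl v
      rw [mfderiv_eq_fderiv, d3.mfderiv, (d2.comp p d1).mfderiv] at d5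
      exact d5
    have d6 : Vc (Φc (t, φ p)) = mfderiv 𝓘(ℝ, E) 𝓘(ℝ, E) φ (Φ t p) (V (Φ t p)) := by
      simp only [Φc, hl]
      exact mpullbackWithin_extChartAt_symm_apply V ht2
    have hinv : (mfderiv 𝓘(ℝ, E) 𝓘(ℝ, E) φ (Φ t p)).IsInvertible :=
      isInvertible_mfderiv_extChartAt ht2
    rw [d4, d6]
    refine (hinv.inverse_comp_apply_of_left).trans ?_
    rw [hinv.inverse_apply_self]
    rfl
  have eB : (mlieBracket 𝓘(ℝ, E) X V p : E) = lieBracket ℝ Xc Vc (φ p) := by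
    have hr : (extChartAt 𝓘(ℝ, E) p).symm ⁻¹' Set.univ ∩ Set.range 𝓘(ℝ, E) = Set.univ := by simp
    rw [← mlieBracketWithin_univ, mlieBracketWithin_apply, hr, mfderiv_extChartAt_self]
    refine (DFunLike.congr_fun (ContinuousLinearMap.inverse_id (R := ℝ) (M := E)) _).trans ?_
    exact congrFun (lieBracketWithin_univ (V := Xc) (W := Vc)) (φ p)
  rw [eB]
  refine (key.congr_of_eventuallyEq eV.symm).congr_deriv ?_
  have e0 : deriv (fun t : ℝ => Φc (t, φ p)) 0 = Xc (φ p) := eX.self_of_nhds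
  rw [lieBracket, lieBracket, eX.fderiv_eq, e0]

end LieDerivative

/-! ### Curves with given velocity, and pullbacks under diffeomorphisms. -/

section Curves

variable {F : Type*} [NormedAddCommGroup F] [NormedSpace ℝ F]
  {N : Type*} [TopologicalSpace N] [ChartedSpace F N]

/-- A straight line in the preferred chart at `x`. It may leave the chart for large `t`, so
smoothness is asserted only at `0`. -/
theorem exists_curve_with_velocity [IsManifold 𝓘(ℝ, F) ∞ N] (x : N) (v : TangentSpace 𝓘(ℝ, F) x) :
    ∃ c : ℝ → N, c 0 = x ∧ ContMDiffAt 𝓘(ℝ, ℝ) 𝓘(ℝ, F) ∞ c 0 ∧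
      (mfderiv 𝓘(ℝ, ℝ) 𝓘(ℝ, F) c 0 (1 : ℝ) : F) = v := by
  let w : F := v
  let l : ℝ → F := fun t => extChartAt 𝓘(ℝ, F) x x + t • w
  have hl0 : l 0 = extChartAt 𝓘(ℝ, F) x x := by simp [l]
  have hl : HasDerivAt l w 0 := by
    have h := ((hasDerivAt_id (0 : ℝ)).smul_const w).const_add (extChartAt 𝓘(ℝ, F) x x)
    rw [one_smul] at h
    exact h
  have hls : ContDiff ℝ ∞ l := by fun_prop
  refine ⟨fun t => (extChartAt 𝓘(ℝ, F) x).symm (l t), by simp [hl0], ?_, ?_⟩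
  · have h1 : ContMDiffAt 𝓘(ℝ, F) 𝓘(ℝ, F) ∞ (extChartAt 𝓘(ℝ, F) x).symm
        (extChartAt 𝓘(ℝ, F) x x) :=
      (contMDiffOn_extChartAt_symm x).contMDiffAt (extChartAt_target_mem_nhds x)
    exact h1.comp_of_eq hls.contMDiff.contMDiffAt hl0
  · have h1 := hasMFDerivAt_extChartAt_symm_self (E := F) x
    have h2 := mfderiv_comp_apply_of_eq (x := (0 : ℝ)) h1.mdifferentiableAt
      (hls.contMDiff.mdifferentiableAt (by simp)) hl0 (1 : ℝ)
    rw [h1.mfderiv, mfderiv_eq_fderiv] at h2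
    exact h2.trans hl.deriv

theorem isInvertible_mfderiv_of_inverse {f g : N → N} (hf : MDifferentiable 𝓘(ℝ, F) 𝓘(ℝ, F) f)
    (hg : MDifferentiable 𝓘(ℝ, F) 𝓘(ℝ, F) g) (hfg : ∀ x, f (g x) = x) (hgf : ∀ x, g (f x) = x)
    (x : N) : (mfderiv 𝓘(ℝ, F) 𝓘(ℝ, F) f x).IsInvertible := by
  let g' : TangentSpace 𝓘(ℝ, F) (f x) →L[ℝ] TangentSpace 𝓘(ℝ, F) x :=
    mfderiv 𝓘(ℝ, F) 𝓘(ℝ, F) g (f x)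
  refine ContinuousLinearMap.IsInvertible.of_inverse (g := g') ?_ ?_
  · ext v
    have h := mfderiv_comp_apply_of_eq (x := f x) (hf x) (hg (f x)) (hgf x) v
    rw [show f ∘ g = id from funext hfg, mfderiv_id] at h
    exact h.symm
  · ext v
    have h := mfderiv_comp_apply (x := x) (hg (f x)) (hf x) v
    rw [show g ∘ f = id from funext hgf, mfderiv_id] at h
    exact h.symm

theorem mpullback_eq_of_mfderiv_apply_eq {f : N → N} {V : Π x : N, TangentSpace 𝓘(ℝ, F) x} {x : N}
    {v : TangentSpace 𝓘(ℝ, F) x} (hf : (mfderiv 𝓘(ℝ, F) 𝓘(ℝ, F) f x).IsInvertible)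
    (hv : mfderiv 𝓘(ℝ, F) 𝓘(ℝ, F) f x v = V (f x)) :
    mpullback 𝓘(ℝ, F) 𝓘(ℝ, F) f V x = v := by
  rw [mpullback_apply, ← hv, hf.inverse_apply_self]

end Curves

/-! ### The adjoint representation and its derivative. -/

section LieGroups

variable {F : Type*} [NormedAddCommGroup F] [NormedSpace ℝ F]
  {G : Type*} [TopologicalSpace G] [ChartedSpace F G] [Group G] [LieGroup 𝓘(ℝ, F) ∞ G]

theorem mdifferentiable_conj (a : G) :
    MDifferentiable 𝓘(ℝ, F) 𝓘(ℝ, F) (fun b : G => a * b * a⁻¹) :=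
  ((contMDiff_mul_right (a := a⁻¹)).comp (contMDiff_mul_left (I := 𝓘(ℝ, F)) (n := ∞)
    (a := a))).mdifferentiable (by simp)

theorem Ad_Ad_inv (a : G) (X : GroupLieAlgebra 𝓘(ℝ, F) G) : Ad a (Ad a⁻¹ X) = X := by
  have h := mfderiv_comp_apply_of_eq (x := (1 : G)) (mdifferentiable_conj (F := F) a 1)
    (mdifferentiable_conj (F := F) a⁻¹ 1) (by simp) X
  rw [show (fun b : G => a * b * a⁻¹) ∘ (fun b : G => a⁻¹ * b * a⁻¹⁻¹) = id by
    funext b; simp [mul_assoc], mfderiv_id] at h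
  exact h.symm

/-- Right translation by `a` after conjugation by `a` is left translation by `a`, so the
differential of right translation carries `Ad a X` to the value at `a` of the left-invariant field
of `X`. -/
theorem mpullback_mul_right_mulInvariantVectorField (a : G) (X : GroupLieAlgebra 𝓘(ℝ, F) G) :
    (mpullback 𝓘(ℝ, F) 𝓘(ℝ, F) (fun b : G => b * a) (mulInvariantVectorField X) 1 : F) =
      Ad a X := by
  have hr : ∀ a : G, MDifferentiable 𝓘(ℝ, F) 𝓘(ℝ, F) (fun b : G => b * a) := fun a =>
    (contMDiff_mul_right (n := ∞) (a := a)).mdifferentiable (by simp)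
  refine mpullback_eq_of_mfderiv_apply_eq (isInvertible_mfderiv_of_inverse (hr a) (hr a⁻¹)
    (by simp) (by simp) 1) ?_
  have h := mfderiv_comp_apply_of_eq (x := (1 : G)) (hr a 1) (mdifferentiable_conj (F := F) a 1)
    (by simp) X
  rw [show (fun b : G => b * a) ∘ (fun b : G => a * b * a⁻¹) = (fun b => a * b) by
    funext b; simp] at h
  have aux : ∀ b : G, b = a →
      (mfderiv 𝓘(ℝ, F) 𝓘(ℝ, F) (fun b : G => a * b) 1 X : F) = mulInvariantVectorField X b := by
    rintro b rfl; rfl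
  exact h.symm.trans (aux _ (one_mul a))

theorem hasMFDerivAt_mul_one_one :
    HasMFDerivAt (𝓘(ℝ, F).prod 𝓘(ℝ, F)) 𝓘(ℝ, F) (fun x : G × G => x.1 * x.2) (1, 1)
      (ContinuousLinearMap.fst ℝ F F + ContinuousLinearMap.snd ℝ F F) := by
  have h : MDifferentiableAt (𝓘(ℝ, F).prod 𝓘(ℝ, F)) 𝓘(ℝ, F) (fun x : G × G => x.1 * x.2) (1, 1) :=
    (contMDiff_mul 𝓘(ℝ, F) ∞).mdifferentiableAt (by simp)
  refine h.hasMFDerivAt.congr_mfderiv ?_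
  ext1 v
  refine (mfderiv_prod_eq_add_apply h).trans ?_
  have e1 : (mfderiv 𝓘(ℝ, F) 𝓘(ℝ, F) (fun z : G => z * 1) 1 v.1 : F) = v.1 := by
    rw [show (fun z : G => z * 1) = id by funext z; simp, mfderiv_id]
    rfl
  have e2 : (mfderiv 𝓘(ℝ, F) 𝓘(ℝ, F) (fun z : G => 1 * z) 1 v.2 : F) = v.2 := by
    rw [show (fun z : G => 1 * z) = id by funext z; simp, mfderiv_id]
    rfl
  exact congrArg₂ (fun x y : F => x + y) e1 e2

/-- A curve through the identity of a Lie group, smooth near `0`, with velocity `X` at `0`. -/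
structure IsCurveThroughOne (c : ℝ → G) (X : GroupLieAlgebra 𝓘(ℝ, F) G) : Prop where
  map_zero : c 0 = 1
  contMDiffAt : ContMDiffAt 𝓘(ℝ, ℝ) 𝓘(ℝ, F) ∞ c 0
  velocity : (mfderiv 𝓘(ℝ, ℝ) 𝓘(ℝ, F) c 0 (1 : ℝ) : F) = X

theorem exists_isCurveThroughOne (X : GroupLieAlgebra 𝓘(ℝ, F) G) :
    ∃ c : ℝ → G, IsCurveThroughOne c X :=
  have ⟨c, h0, h1, h2⟩ := exists_curve_with_velocity (1 : G) X
  ⟨c, h0, h1, h2⟩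

namespace IsCurveThroughOne

variable {c : ℝ → G} {X : GroupLieAlgebra 𝓘(ℝ, F) G}

theorem mdifferentiableAt (hc : IsCurveThroughOne c X) :
    MDifferentiableAt 𝓘(ℝ, ℝ) 𝓘(ℝ, F) c 0 :=
  hc.contMDiffAt.mdifferentiableAt (by simp)

theorem mfderiv_comp_apply (hc : IsCurveThroughOne c X) {E N : Type*} [NormedAddCommGroup E]
    [NormedSpace ℝ E] [TopologicalSpace N] [ChartedSpace E N] {f : G → N}
    (hf : MDifferentiableAt 𝓘(ℝ, F) 𝓘(ℝ, E) f 1) :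
    (mfderiv 𝓘(ℝ, ℝ) 𝓘(ℝ, E) (fun t => f (c t)) 0 (1 : ℝ) : E) =
      mfderiv 𝓘(ℝ, F) 𝓘(ℝ, E) f 1 X := by
  refine (mfderiv_comp_apply_of_eq (x := (0 : ℝ)) hf hc.mdifferentiableAt hc.map_zero
    (1 : ℝ)).trans ?_
  exact congrArg (mfderiv 𝓘(ℝ, F) 𝓘(ℝ, E) f 1 : F → E) hc.velocity

/-- Multiplication has differential `(u, w) ↦ u + w` at `(1, 1)`; differentiating `c t * (c t)⁻¹ =
1` gives the velocity. -/
theorem inv (hc : IsCurveThroughOne c X) : IsCurveThroughOne (fun t => (c t)⁻¹) (-X) where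
  map_zero := by simp [hc.map_zero]
  contMDiffAt := (contMDiff_inv 𝓘(ℝ, F) ∞).contMDiffAt.comp 0 hc.contMDiffAt
  velocity := by
    have hi : MDifferentiableAt 𝓘(ℝ, ℝ) 𝓘(ℝ, F) (fun t => (c t)⁻¹) 0 :=
      ((contMDiff_inv 𝓘(ℝ, F) ∞).contMDiffAt.comp 0 hc.contMDiffAt).mdifferentiableAt (by simp)
    have h := mfderiv_comp_apply_of_eq (x := (0 : ℝ))
      (hasMFDerivAt_mul_one_one (F := F) (G := G)).mdifferentiableAt
      (hc.mdifferentiableAt.prodMk hi) (by simp [hc.map_zero]) (1 : ℝ)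
    rw [mfderiv_prodMk hc.mdifferentiableAt hi, hasMFDerivAt_mul_one_one.mfderiv,
      show (fun x : G × G => x.1 * x.2) ∘ (fun t => (c t, (c t)⁻¹)) = fun _ => 1 by
        funext t; simp, mfderiv_const] at h
    let u : F := mfderiv 𝓘(ℝ, ℝ) 𝓘(ℝ, F) c 0 (1 : ℝ)
    let w : F := mfderiv 𝓘(ℝ, ℝ) 𝓘(ℝ, F) (fun t => (c t)⁻¹) 0 (1 : ℝ)
    have h' : 0 = u + w := h
    rw [show u = X from hc.velocity] at h'
    exact eq_neg_of_add_eq_zero_right h'.symm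

/-- The derivative of the adjoint representation is the Lie bracket. -/
theorem hasDerivAt_Ad [CompleteSpace F] (hc : IsCurveThroughOne c X)
    (Y : GroupLieAlgebra 𝓘(ℝ, F) G) :
    HasDerivAt (F := F) (fun t => Ad (c t) Y) (⁅X, Y⁆ : GroupLieAlgebra 𝓘(ℝ, F) G) 0 := by
  have : LieGroup 𝓘(ℝ, F) (minSmoothness ℝ 3) G := LieGroup.of_le (n := ∞) (by
    rw [minSmoothness_of_isRCLikeNormedField]; exact ENat.LEInfty.out)
  -- Right translations by `c t` have the left-invariant field of `X` as initial velocity, and they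
  -- pull the field of `Y` back to `Ad (c t) Y` at `1`.
  have h := hasDerivAt_mpullback (Φ := fun t (b : G) => b * c t) (p := 1)
    (X := mulInvariantVectorField X) (V := mulInvariantVectorField Y) ?_ ?_ ?_ ?_
  · refine h.congr_of_eventuallyEq (.of_forall fun t => ?_)
    exact (mpullback_mul_right_mulInvariantVectorField (c t) Y).symm
  · exact (contMDiff_mul 𝓘(ℝ, F) ∞).contMDiffAt.comp ((0 : ℝ), (1 : G))
      (contMDiffAt_snd.prodMk (hc.contMDiffAt.comp ((0 : ℝ), (1 : G)) contMDiffAt_fst))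
  · intro q
    simp [hc.map_zero]
  · intro q
    exact hc.mfderiv_comp_apply
      ((contMDiff_mul_left (I := 𝓘(ℝ, F)) (n := ∞) (a := q)).mdifferentiableAt (by simp))
  · exact mdifferentiableAt_mulInvariantVectorField Y

end IsCurveThroughOne

end LieGroups


theorem hasDerivAt_bilin {E : Type*} [NormedAddCommGroup E] [NormedSpace ℝ E]
    [FiniteDimensional ℝ E] (B : E →ₗ[ℝ] E →ₗ[ℝ] ℝ) {f g : ℝ → E} {f' g' : E} {t : ℝ}
    (hf : HasDerivAt f f' t) (hg : HasDerivAt g g' t) :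
    HasDerivAt (fun t => B (f t) (g t)) (B f' (g t) + B (f t) g') t := by
  have h : HasDerivAt (fun t => B.toContinuousBilinearMap (f t)) (B.toContinuousBilinearMap f') t :=
    B.toContinuousBilinearMap.hasFDerivAt.comp_hasDerivAt t hf
  exact h.clm_apply hg

/-- The infinitesimal form of `Ad`-invariance: differentiate the constant function `t ↦ Q(Ad (c t)
Y, Ad (c t) Z)` at `0`. -/
theorem BiinvariantMetric.form_lie {F : Type*} [NormedAddCommGroup F] [NormedSpace ℝ F]
    [FiniteDimensional ℝ F] {G : Type*} [TopologicalSpace G] [ChartedSpace F G] [Group G]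
    [LieGroup 𝓘(ℝ, F) ∞ G] (Q : BiinvariantMetric F G) (X Y Z : GroupLieAlgebra 𝓘(ℝ, F) G) :
    Q.form ⁅X, Y⁆ Z + Q.form Y ⁅X, Z⁆ = 0 := by
  have : CompleteSpace F := FiniteDimensional.complete ℝ F
  obtain ⟨c, hc⟩ := exists_isCurveThroughOne X
  have h := hasDerivAt_bilin (E := F) Q.form (hc.hasDerivAt_Ad Y) (hc.hasDerivAt_Ad Z)
  have h1 : ∀ W : GroupLieAlgebra 𝓘(ℝ, F) G, Ad (c 0) W = W := fun W => by
    have : (fun b : G => 1 * b * 1⁻¹) = id := by funext b; simp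
    rw [hc.map_zero, Ad, this, mfderiv_id]
    rfl
  have h2 := (hasDerivAt_const (0 : ℝ) (Q.form Y Z)).unique
    (h.congr_of_eventuallyEq (.of_forall fun t => (Q.ad_invariant (c t) Y Z).symm))
  rw [h1, h1] at h2
  exact h2.symm

/-! ### Action fields under translations, and their brackets. -/

section Action

variable {E : Type*} [NormedAddCommGroup E] [NormedSpace ℝ E]
  {M : Type*} [TopologicalSpace M] [ChartedSpace E M]
  {F : Type*} [NormedAddCommGroup F] [NormedSpace ℝ F]
  {G : Type*} [TopologicalSpace G] [ChartedSpace F G] [Group G]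
  [MulAction G M]

variable (F) in
theorem mdifferentiable_const_smul [ContMDiffSMul 𝓘(ℝ, F) 𝓘(ℝ, E) ∞ G M] (a : G) :
    MDifferentiable 𝓘(ℝ, E) 𝓘(ℝ, E) (fun q : M => a • q) :=
  (ContMDiffSMul.contMDiff_const_smul (I := 𝓘(ℝ, F)) (n := ∞) a).mdifferentiable (by simp)

variable (F) in
theorem isInvertible_mfderiv_const_smul [ContMDiffSMul 𝓘(ℝ, F) 𝓘(ℝ, E) ∞ G M] (a : G) (p : M) :
    (mfderiv 𝓘(ℝ, E) 𝓘(ℝ, E) (fun q : M => a • q) p).IsInvertible :=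
  isInvertible_mfderiv_of_inverse (mdifferentiable_const_smul F a)
    (mdifferentiable_const_smul F a⁻¹) (smul_inv_smul a) (inv_smul_smul a) p

variable [ContMDiffSMul 𝓘(ℝ, F) 𝓘(ℝ, E) ∞ G M]

variable (E F G) in
theorem mdifferentiable_smul_const (p : M) :
    MDifferentiable 𝓘(ℝ, F) 𝓘(ℝ, E) (fun a : G => a • p) :=
  ((ContMDiffSMul.contMDiff_smul (I := 𝓘(ℝ, F)) (I' := 𝓘(ℝ, E)) (n := ∞) (G := G) (M := M)).comp
    (contMDiff_id.prodMk contMDiff_const)).mdifferentiable (by simp)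

variable [LieGroup 𝓘(ℝ, F) ∞ G]

/-- Differentiate `a • b • q = (a * b * a⁻¹) • a • q` in `b` at `1`. -/
theorem mfderiv_const_smul_actionField (a : G) (X : GroupLieAlgebra 𝓘(ℝ, F) G) (q : M) :
    mfderiv 𝓘(ℝ, E) 𝓘(ℝ, E) (fun q : M => a • q) q (actionField E X q) =
      actionField E (Ad a X) (a • q) := by
  have h1 := mfderiv_comp_apply_of_eq (x := (1 : G))
    (mdifferentiable_const_smul F a q)
    (mdifferentiable_smul_const E F G q 1) (one_smul G q) X
  have h2 := mfderiv_comp_apply_of_eq (x := (1 : G)) (mdifferentiable_smul_const E F G (a • q) 1)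
    (mdifferentiable_conj (F := F) a 1) (by simp) X
  rw [show (fun b : G => b • a • q) ∘ (fun b : G => a * b * a⁻¹) =
    (fun q : M => a • q) ∘ (fun b : G => b • q) by funext b; simp [smul_smul]] at h2
  exact h1.symm.trans h2

theorem mpullback_const_smul_actionField (a : G) (X : GroupLieAlgebra 𝓘(ℝ, F) G) (p : M) :
    mpullback 𝓘(ℝ, E) 𝓘(ℝ, E) (fun q : M => a • q) (fun q => actionField E X q) p =
      actionField E (Ad a⁻¹ X) p :=
  mpullback_eq_of_mfderiv_apply_eq
    (isInvertible_mfderiv_const_smul F a p)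
    (by rw [mfderiv_const_smul_actionField, Ad_Ad_inv])

variable {c : ℝ → G} {X : GroupLieAlgebra 𝓘(ℝ, F) G}

namespace IsCurveThroughOne

theorem contMDiffAt_smul (hc : IsCurveThroughOne c X) (p : M) :
    ContMDiffAt (𝓘(ℝ, ℝ).prod 𝓘(ℝ, E)) 𝓘(ℝ, E) ∞ (fun x : ℝ × M => c x.1 • x.2) (0, p) :=
  (ContMDiffSMul.contMDiff_smul (I := 𝓘(ℝ, F)) (n := ∞)).contMDiffAt.comp ((0 : ℝ), p)
    ((hc.contMDiffAt.comp ((0 : ℝ), p) contMDiffAt_fst).prodMk contMDiffAt_snd)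

theorem mfderiv_smul (hc : IsCurveThroughOne c X) (p : M) :
    (mfderiv 𝓘(ℝ, ℝ) 𝓘(ℝ, E) (fun t => c t • p) 0 (1 : ℝ) : E) = actionField E X p :=
  hc.mfderiv_comp_apply (mdifferentiable_smul_const E F G p 1)

variable [IsManifold 𝓘(ℝ, E) ∞ M] [CompleteSpace E]

theorem hasDerivAt_mpullback_smul (hc : IsCurveThroughOne c X) {p : M}
    {V : Π q : M, TangentSpace 𝓘(ℝ, E) q} (hV : MDiffAt (T% V) p) :
    HasDerivAt (F := E) (fun t => mpullback 𝓘(ℝ, E) 𝓘(ℝ, E) (fun q : M => c t • q) V p)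
      (mlieBracket 𝓘(ℝ, E) (fun q => actionField E X q) V p) 0 :=
  hasDerivAt_mpullback (hc.contMDiffAt_smul p) (fun q => by simp [hc.map_zero])
    (fun q => hc.mfderiv_smul q) hV

end IsCurveThroughOne

/-- The map `X ↦ X^*` reverses the sign of the Lie bracket. -/
theorem mlieBracket_actionField [IsManifold 𝓘(ℝ, E) ∞ M] [CompleteSpace E] [CompleteSpace F]
    (X Y : GroupLieAlgebra 𝓘(ℝ, F) G) (p : M) :
    mlieBracket 𝓘(ℝ, E) (fun q => actionField E X q) (fun q => actionField E Y q) p =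
      -actionField E ⁅X, Y⁆ p := by
  have : LieGroup 𝓘(ℝ, F) (minSmoothness ℝ 3) G := LieGroup.of_le (n := ∞) (by
    rw [minSmoothness_of_isRCLikeNormedField]; exact ENat.LEInfty.out)
  obtain ⟨c, hc⟩ := exists_isCurveThroughOne X
  have h1 := hc.hasDerivAt_mpullback_smul (mdiffAt_actionField (E := E) Y p)
  let L : F →L[ℝ] E := mfderiv 𝓘(ℝ, F) 𝓘(ℝ, E) (fun a : G => a • p) 1
  -- Pulling `Y^*` back by `c t` gives the action field of `Ad (c t)⁻¹ Y`; the inverse curve has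
  -- velocity `-X`, which is the source of the sign.
  have h2 : HasDerivAt (fun t => L (Ad (c t)⁻¹ Y)) (L (⁅-X, Y⁆ : GroupLieAlgebra 𝓘(ℝ, F) G)) 0 :=
    L.hasFDerivAt.comp_hasDerivAt (0 : ℝ) (hc.inv.hasDerivAt_Ad Y)
  rw [neg_lie] at h2
  refine (h1.unique (h2.congr_of_eventuallyEq (.of_forall fun t => ?_))).trans (map_neg L _)
  exact mpullback_const_smul_actionField (c t) Y p

end Action

/-! ### The orbit tensor, the Killing property and vertical pairs. -/

section Riemannian

variable {E : Type*} [NormedAddCommGroup E] [NormedSpace ℝ E] [FiniteDimensional ℝ E]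
  {M : Type*} [TopologicalSpace M] [ChartedSpace E M]
  [RiemannianBundle (fun x : M => TangentSpace 𝓘(ℝ, E) x)]
  {F : Type*} [NormedAddCommGroup F] [NormedSpace ℝ F] [FiniteDimensional ℝ F]
  {G : Type*} [TopologicalSpace G] [ChartedSpace F G] [Group G] [MulAction G M]

/-- The defining identity of `P` on `𝔪_p` extends to all of `𝔤`, because both sides vanish when
either argument lies in `𝔤_p` (the values of `P` are `Q`-orthogonal to `𝔤_p`). Thus `q ↦ Q(P_q X,
Z)` is `g(X^*, Z^*)`, although the splitting of `𝔤` varies with `q`. -/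
theorem form_orbitTensorExt (Q : BiinvariantMetric F G) (p : M)
    (X Y : GroupLieAlgebra 𝓘(ℝ, F) G) :
    Q.form (orbitTensorExt E Q p X) Y = inner ℝ (actionField E X p) (actionField E Y p) := by
  have hc := isCompl_isotropyComplement (E := E) Q p
  have key : ∀ X : GroupLieAlgebra 𝓘(ℝ, F) G, ∃ Xm : isotropyComplement E Q p,
      ∃ Xi ∈ isotropyAlgebra E F G p, X = Xm + Xi := fun X => by
    have hX : X ∈ isotropyComplement E Q p ⊔ isotropyAlgebra E F G p := by
      rw [hc.sup_eq_top]; trivial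
    obtain ⟨a, ha, b, hb, hab⟩ := Submodule.mem_sup.1 hX
    exact ⟨⟨a, ha⟩, b, hb, hab.symm⟩
  obtain ⟨Xm, Xi, hXi, rfl⟩ := key X
  obtain ⟨Ym, Yi, hYi, rfl⟩ := key Y
  have hP : orbitTensorExt E Q p (Xm + Xi) = orbitTensor E Q p Xm := by
    rw [map_add, orbitTensorExt_coe]
    have : orbitTensorExt E Q p Xi = 0 := by
      rw [orbitTensorExt, LinearMap.comp_apply, LinearMap.comp_apply,
        (Submodule.projectionOnto_apply_eq_zero_iff hc).2 hXi, map_zero, map_zero]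
    rw [this, add_zero]
  have hA : ∀ (Z Zi : GroupLieAlgebra 𝓘(ℝ, F) G), Zi ∈ isotropyAlgebra E F G p →
      actionField E (Z + Zi) p = actionField E Z p := fun Z Zi hZi => by
    rw [actionField, map_add, LinearMap.mem_ker.1 hZi, add_zero, actionField]
  have h0 : Q.form (orbitTensor E Q p Xm) Yi = 0 := by
    rw [Q.symm]
    exact (orbitTensor E Q p Xm).2 Yi hYi
  rw [hP, map_add, h0, add_zero, hA _ _ hXi, hA _ _ hYi, orbitTensor_spec]

variable [IsManifold 𝓘(ℝ, E) ∞ M]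
  [IsContMDiffRiemannianBundle 𝓘(ℝ, E) ∞ E (fun x : M => TangentSpace 𝓘(ℝ, E) x)]

theorem leviCivita_sub_leviCivita {U W : Π x : M, TangentSpace 𝓘(ℝ, E) x} {x : M}
    (hU : MDiffAt (T% U) x) (hW : MDiffAt (T% W) x) :
    leviCivita W x (U x) - leviCivita U x (W x) = mlieBracket 𝓘(ℝ, E) U W x :=
  (CovariantDerivative.torsion_eq_zero_iff _).1 leviCivita_torsion hU hW

variable [LieGroup 𝓘(ℝ, F) ∞ G] [ContMDiffSMul 𝓘(ℝ, F) 𝓘(ℝ, E) ∞ G M]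
  {V W : Π x : M, TangentSpace 𝓘(ℝ, E) x} {p : M}

/-- The Lie derivative of the metric along an action field vanishes. -/
theorem mvfderiv_inner_actionField (hiso : IsIsometricAction E M G)
    (X : GroupLieAlgebra 𝓘(ℝ, F) G) (hV : MDiffAt (T% V) p) (hW : MDiffAt (T% W) p) :
    mvfderiv 𝓘(ℝ, E) (fun y => inner ℝ (V y) (W y)) p (actionField E X p) =
      inner ℝ (mlieBracket 𝓘(ℝ, E) (fun q => actionField E X q) V p) (W p) +
      inner ℝ (V p) (mlieBracket 𝓘(ℝ, E) (fun q => actionField E X q) W p) := by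
  have : CompleteSpace E := FiniteDimensional.complete ℝ E
  obtain ⟨c, hc⟩ := exists_isCurveThroughOne X
  have hf := mdiffAt_inner hV hW
  have h1 := hasDerivAt_bilin (E := E) (innerₗ (TangentSpace 𝓘(ℝ, E) p))
    (hc.hasDerivAt_mpullback_smul hV) (hc.hasDerivAt_mpullback_smul hW)
  have hone : (fun q : M => (1 : G) • q) = id := by funext q; simp
  have h0 : ∀ V : Π x : M, TangentSpace 𝓘(ℝ, E) x,
      mpullback 𝓘(ℝ, E) 𝓘(ℝ, E) (fun q : M => c 0 • q) V p = V p := fun V => by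
    rw [hc.map_zero, hone, mpullback_id]
  rw [h0, h0] at h1
  -- Since `c t` acts isometrically, the inner product at `c t • p` can be computed in the fixed
  -- space `T_p M`, where the product rule applies to the pullbacks.
  have h2 : ∀ t, (inner ℝ (V (c t • p)) (W (c t • p)) : ℝ) =
      inner ℝ (mpullback 𝓘(ℝ, E) 𝓘(ℝ, E) (fun q : M => c t • q) V p)
        (mpullback 𝓘(ℝ, E) 𝓘(ℝ, E) (fun q : M => c t • q) W p) := fun t => by
    have hi := isInvertible_mfderiv_const_smul (E := E) F (c t) p
    rw [← hiso (c t) p, mpullback_apply, mpullback_apply, hi.self_apply_inverse,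
      hi.self_apply_inverse]
  have h3 : HasDerivAt (fun t => (inner ℝ (V (c t • p)) (W (c t • p)) : ℝ)) _ 0 :=
    h1.congr_of_eventuallyEq (.of_forall h2)
  have hcp : MDifferentiableAt 𝓘(ℝ, ℝ) 𝓘(ℝ, E) (fun t => c t • p) 0 :=
    ((hc.contMDiffAt_smul p).comp (0 : ℝ) (contMDiffAt_id.prodMk contMDiffAt_const)).mdifferentiableAt
      (by simp)
  have h4 := mvfderiv_comp_apply_of_eq (0 : ℝ) hf hcp (by simp [hc.map_zero]) (1 : ℝ)
  have h5 : (mfderiv 𝓘(ℝ, ℝ) 𝓘(ℝ, E) (fun t => c t • p) 0 (1 : ℝ) : E) = actionField E X p :=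
    hc.mfderiv_smul p
  have h6 := congrArg (mvfderiv 𝓘(ℝ, E) (fun y => (inner ℝ (V y) (W y) : ℝ)) p : E → ℝ) h5
  refine h6.symm.trans (h4.symm.trans ?_)
  rw [mvfderiv, mfderiv_eq_fderiv]
  exact h3.deriv

/-- Action fields of isometric actions are Killing fields. -/
theorem inner_leviCivita_actionField_skew (hiso : IsIsometricAction E M G)
    (X : GroupLieAlgebra 𝓘(ℝ, F) G) (p : M) (u v : TangentSpace 𝓘(ℝ, E) p) :
    inner ℝ (leviCivita (fun q => actionField E X q) p u) v =
      -inner ℝ (leviCivita (fun q => actionField E X q) p v) u := by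
  have hu := mdifferentiableAt_extend 𝓘(ℝ, E) E u
  have hv := mdifferentiableAt_extend 𝓘(ℝ, E) E v
  have hX := mdiffAt_actionField (E := E) X p
  have h1 := mvfderiv_inner_actionField hiso X hu hv
  rw [leviCivita_metric (X := fun q => actionField E X q) hX hu hv,
    ← leviCivita_sub_leviCivita hX hu, ← leviCivita_sub_leviCivita hX hv, inner_sub_left,
    inner_sub_right] at h1
  simp only [extend_apply_self] at h1
  rw [real_inner_comm u]
  linarith

theorem two_mul_extDerivOneForm_dualForm {U : Π x : M, TangentSpace 𝓘(ℝ, E) x}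
    (Z : GroupLieAlgebra 𝓘(ℝ, F) G) (hU : MDiffAt (T% U) p) (hW : MDiffAt (T% W) p) :
    2 * extDerivOneForm (dualForm E M Z) p (U p) (W p) =
      mvfderiv 𝓘(ℝ, E) (fun y => inner ℝ (actionField E Z y) (W y)) p (U p)
        - mvfderiv 𝓘(ℝ, E) (fun y => inner ℝ (actionField E Z y) (U y)) p (W p)
        - inner ℝ (actionField E Z p) (mlieBracket 𝓘(ℝ, E) U W p) :=
  two_mul_extDerivOneForm_apply
    (fun _ hV => mdiffAt_inner (mdiffAt_actionField Z p) hV) hU hW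

/-- The exterior derivative of the one-form dual to a Killing field `Z^*` is `∇ Z^*`. -/
theorem extDerivOneForm_dualForm (hiso : IsIsometricAction E M G)
    (Z : GroupLieAlgebra 𝓘(ℝ, F) G) (p : M) (u v : TangentSpace 𝓘(ℝ, E) p) :
    extDerivOneForm (dualForm E M Z) p u v =
      inner ℝ (leviCivita (fun q => actionField E Z q) p u) v := by
  have hu := mdifferentiableAt_extend 𝓘(ℝ, E) E u
  have hv := mdifferentiableAt_extend 𝓘(ℝ, E) E v
  have hZ := mdiffAt_actionField (E := E) Z p
  have h1 := two_mul_extDerivOneForm_dualForm Z hu hv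
  rw [leviCivita_metric hu hZ hv, leviCivita_metric hv hZ hu, ← leviCivita_sub_leviCivita hu hv,
    inner_sub_right] at h1
  simp only [extend_apply_self] at h1
  have h2 := inner_leviCivita_actionField_skew hiso Z p u v
  linarith

/-- With `X^*` and `Y^*` as extensions, invariance of the metric and the sign rule for brackets
leave `g([Y,Z]^*, X^*) - g([X,Z]^*, Y^*) - g([X,Y]^*, Z^*)`. Each term is rewritten with `P`, and
skewness of `ad X` and `ad Y` moves the brackets off `Z`. -/
theorem two_mul_extDerivOneForm_dualForm_vertical (hiso : IsIsometricAction E M G)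
    (Q : BiinvariantMetric F G) (p : M) (X Y Z : GroupLieAlgebra 𝓘(ℝ, F) G) :
    2 * extDerivOneForm (dualForm E M Z) p (actionField E X p) (actionField E Y p) =
      Q.form (⁅orbitTensorExt E Q p X, Y⁆ + ⁅X, orbitTensorExt E Q p Y⁆
        - orbitTensorExt E Q p ⁅X, Y⁆) Z := by
  have : CompleteSpace E := FiniteDimensional.complete ℝ E
  have : CompleteSpace F := FiniteDimensional.complete ℝ F
  have : LieGroup 𝓘(ℝ, F) (minSmoothness ℝ 3) G := LieGroup.of_le (n := ∞) (by
    rw [minSmoothness_of_isRCLikeNormedField]; exact ENat.LEInfty.out)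
  have hm := fun X : GroupLieAlgebra 𝓘(ℝ, F) G => mdiffAt_actionField (E := E) X p
  have hneg : actionField E ⁅Y, X⁆ p = -actionField E ⁅X, Y⁆ p := by
    rw [← lie_skew, actionField, map_neg, actionField]
  have h1 := two_mul_extDerivOneForm_dualForm (U := fun q => actionField E X q)
    (W := fun q => actionField E Y q) Z (hm X) (hm Y)
  rw [mvfderiv_inner_actionField hiso X (hm Z) (hm Y),
    mvfderiv_inner_actionField hiso Y (hm Z) (hm X)] at h1
  simp only [mlieBracket_actionField, hneg, inner_neg_left, inner_neg_right, neg_neg] at h1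
  rw [real_inner_comm (actionField E Y p), real_inner_comm (actionField E X p),
    real_inner_comm _ (actionField E Z p), ← form_orbitTensorExt Q, ← form_orbitTensorExt Q,
    ← form_orbitTensorExt Q] at h1
  have h2 := Q.form_lie X (orbitTensorExt E Q p Y) Z
  have h3 := Q.form_lie Y (orbitTensorExt E Q p X) Z
  rw [← lie_skew, map_neg, LinearMap.neg_apply] at h3
  rw [map_sub, map_add, LinearMap.sub_apply, LinearMap.add_apply]
  linarith

end Riemannian

/-! ### Smooth orthogonalisation against a local frame. -/

theorem contMDiffAt_det {E : Type*} [NormedAddCommGroup E] [NormedSpace ℝ E]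
    {M : Type*} [TopologicalSpace M] [ChartedSpace E M] {ι : Type*} [Fintype ι] [DecidableEq ι]
    {A : M → Matrix ι ι ℝ} {p : M}
    (hA : ∀ i j, ContMDiffAt 𝓘(ℝ, E) 𝓘(ℝ) ∞ (fun q => A q i j) p) :
    ContMDiffAt 𝓘(ℝ, E) 𝓘(ℝ) ∞ (fun q => (A q).det) p := by
  simp only [Matrix.det_apply']
  exact contMDiffAt_finsetSum fun σ _ =>
    contMDiffAt_const.mul (contMDiffAt_finsetProd fun i _ => hA _ _)

section GramProjection

variable {E : Type*} [NormedAddCommGroup E] [NormedSpace ℝ E] [FiniteDimensional ℝ E]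
  {M : Type*} [TopologicalSpace M] [ChartedSpace E M] [IsManifold 𝓘(ℝ, E) ∞ M]
  [RiemannianBundle (fun x : M => TangentSpace 𝓘(ℝ, E) x)]
  [IsContMDiffRiemannianBundle 𝓘(ℝ, E) ∞ E (fun x : M => TangentSpace 𝓘(ℝ, E) x)]

/-- A vector field `S` can be made orthogonal to a local frame `W` of a distribution by
subtracting a smooth combination of the `W i`. -/
theorem exists_contMDiffAt_orthogonal {ι : Type*} [Fintype ι] [DecidableEq ι]
    {W : ι → Π q : M, TangentSpace 𝓘(ℝ, E) q} {S : Π q : M, TangentSpace 𝓘(ℝ, E) q} {p : M}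
    (hW : ∀ i, ContMDiffAt 𝓘(ℝ, E) 𝓘(ℝ, E).tangent ∞
      (fun q => (⟨q, W i q⟩ : TangentBundle 𝓘(ℝ, E) M)) p)
    (hS : ContMDiffAt 𝓘(ℝ, E) 𝓘(ℝ, E).tangent ∞
      (fun q => (⟨q, S q⟩ : TangentBundle 𝓘(ℝ, E) M)) p)
    (hlin : LinearIndependent ℝ (fun i => W i p)) (hSp : ∀ i, inner ℝ (W i p) (S p) = 0) :
    ∃ V : Π q : M, TangentSpace 𝓘(ℝ, E) q,
      ContMDiffAt 𝓘(ℝ, E) 𝓘(ℝ, E).tangent ∞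
        (fun q => (⟨q, V q⟩ : TangentBundle 𝓘(ℝ, E) M)) p ∧ V p = S p ∧
      ∀ᶠ q in 𝓝 p, LinearIndependent ℝ (fun i => W i q) ∧ (∀ i, inner ℝ (W i q) (V q) = 0) ∧
        S q - V q ∈ Submodule.span ℝ (Set.range fun i => W i q) := by
  let A : M → Matrix ι ι ℝ := fun q => Matrix.gram ℝ (fun i => W i q)
  let b : M → ι → ℝ := fun q i => inner ℝ (W i q) (S q)
  -- The coefficients solve the Gram system `A c = b`. Cramer's rule makes them visibly smooth where
  -- the Gram determinant is nonzero, which is an open condition that also encodes independence of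
  -- the frame.
  let c : ι → M → ℝ := fun i q => ((A q).det)⁻¹ * (A q).cramer (b q) i
  have hA : ∀ i j, ContMDiffAt 𝓘(ℝ, E) 𝓘(ℝ) ∞ (fun q => A q i j) p := fun i j =>
    ContMDiffAt.inner_bundle (E := fun x : M => TangentSpace 𝓘(ℝ, E) x) (hW i) (hW j)
  have hb : ∀ i, ContMDiffAt 𝓘(ℝ, E) 𝓘(ℝ) ∞ (fun q => b q i) p := fun i =>
    ContMDiffAt.inner_bundle (E := fun x : M => TangentSpace 𝓘(ℝ, E) x) (hW i) hS
  have hdet := contMDiffAt_det hA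
  have hp : (A p).det ≠ 0 := Matrix.det_gram_ne_zero_iff_linearIndependent.2 hlin
  have hc : ∀ i, ContMDiffAt 𝓘(ℝ, E) 𝓘(ℝ) ∞ (c i) p := fun i => by
    refine (hdet.inv₀ hp).mul ?_
    simp only [Matrix.cramer_apply]
    refine contMDiffAt_det fun k l => ?_
    by_cases h : l = i
    · subst h; simpa using hb k
    · simpa [Matrix.updateCol_apply, h] using hA k l
  refine ⟨fun q => S q - ∑ i, c i q • W i q, ?_, ?_, ?_⟩
  · exact hS.sub_section (.sum_section fun i _ => (hc i).smul_section (hW i))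
  · have : b p = 0 := funext hSp
    simp [c, this]
  · filter_upwards [hdet.continuousAt.eventually_ne hp] with q hq
    refine ⟨Matrix.det_gram_ne_zero_iff_linearIndependent.1 hq, fun i => ?_, ?_⟩
    · have h := congrFun (Matrix.mulVec_cramer (A q) (b q)) i
      simp only [Matrix.mulVec, dotProduct, Pi.smul_apply, smul_eq_mul] at h
      have h2 : ∑ j, c j q * A q i j = b q i := by
        have : ∀ j, c j q * A q i j = ((A q).det)⁻¹ * (A q i j * (A q).cramer (b q) j) :=
          fun j => by ring
        simp only [this]
        rw [← Finset.mul_sum, h, inv_mul_cancel_left₀ hq]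
      simp only [inner_sub_right, inner_sum, inner_smul_right]
      exact sub_eq_zero.2 h2.symm
    · rw [sub_sub_cancel]
      exact Submodule.sum_mem _ fun i _ => Submodule.smul_mem _ _ (Submodule.subset_span ⟨i, rfl⟩)

end GramProjection

/-! ### Normal and horizontal extensions. -/

section Action

variable {E : Type*} [NormedAddCommGroup E] [NormedSpace ℝ E] [FiniteDimensional ℝ E]
  {M : Type*} [TopologicalSpace M] [ChartedSpace E M]
  {F : Type*} [NormedAddCommGroup F] [NormedSpace ℝ F] [FiniteDimensional ℝ F]
  {G : Type*} [TopologicalSpace G] [ChartedSpace F G] [Group G] [LieGroup 𝓘(ℝ, F) ∞ G]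
  [MulAction G M] [ContMDiffSMul 𝓘(ℝ, F) 𝓘(ℝ, E) ∞ G M]

/-- The invertible differential of `a` maps `X^*(p)` to `(Ad a X)^*(a • p)`, hence one vertical
space onto the other. -/
theorem finrank_vertical_smul (a : G) (p : M) :
    Module.finrank ℝ (vertical E F G (a • p)) = Module.finrank ℝ (vertical E F G p) := by
  obtain ⟨e, he⟩ := isInvertible_mfderiv_const_smul (E := E) F a p
  have h : vertical E F G (a • p) = (vertical E F G p).map (e.toLinearEquiv : _ →ₗ[ℝ] _) := by
    have hX : ∀ X : GroupLieAlgebra 𝓘(ℝ, F) G,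
        e (actionField E X p) = actionField E (Ad a X) (a • p) := fun X => by
      rw [← mfderiv_const_smul_actionField, ← he]; rfl
    ext v
    constructor
    · rintro ⟨X, rfl⟩
      refine ⟨actionField E (Ad a⁻¹ X) p, actionField_mem_vertical _ p, ?_⟩
      refine (hX _).trans ?_
      rw [Ad_Ad_inv]; rfl
    · rintro ⟨_, ⟨X, rfl⟩, rfl⟩
      exact ⟨Ad a X, (hX X).symm⟩
  rw [h, LinearEquiv.finrank_map_eq]

variable [IsManifold 𝓘(ℝ, E) ∞ M] [RiemannianBundle (fun x : M => TangentSpace 𝓘(ℝ, E) x)]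
  [IsContMDiffRiemannianBundle 𝓘(ℝ, E) ∞ E (fun x : M => TangentSpace 𝓘(ℝ, E) x)]

/-- A smooth extension of a horizontal vector at `p` that is, near `p`, the horizontal part of
`extend E v` at all points `q` with orbits of the same dimension as that of `p`. -/
theorem exists_extension_eq_starProjection (Q : BiinvariantMetric F G) {p : M}
    {v : TangentSpace 𝓘(ℝ, E) p} (hv : v ∈ horizontal E F G p) :
    ∃ V : Π q : M, TangentSpace 𝓘(ℝ, E) q,
      ContMDiffAt 𝓘(ℝ, E) 𝓘(ℝ, E).tangent ∞
        (fun q => (⟨q, V q⟩ : TangentBundle 𝓘(ℝ, E) M)) p ∧ V p = v ∧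
      ∀ᶠ q in 𝓝 p, Module.finrank ℝ (vertical E F G q) = Module.finrank ℝ (vertical E F G p) →
        V q = (horizontal E F G q).starProjection (extend E v q) := by
  let b := Module.finBasis ℝ (isotropyComplement E Q p)
  let X : Fin (Module.finrank ℝ (isotropyComplement E Q p)) → GroupLieAlgebra 𝓘(ℝ, F) G :=
    fun i => b i
  have hlin : LinearIndependent ℝ fun i => actionField E (X i) p :=
    (b.map (complementEquivVertical Q p)).linearIndependent.map' (vertical E F G p).subtype
      (Submodule.ker_subtype _)
  obtain ⟨V, hV, hVp, hVq⟩ := exists_contMDiffAt_orthogonal (S := extend E v)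
    (W := fun i q => actionField E (X i) q) (fun i => (contMDiff_actionField (X i)).contMDiffAt)
    (contMDiffAt_extend 𝓘(ℝ, E) E v) hlin
    (fun i => by
      rw [extend_apply_self]
      exact hv _ (actionField_mem_vertical (X i) p))
  refine ⟨V, hV, by rw [hVp, extend_apply_self], ?_⟩
  filter_upwards [hVq] with q ⟨h1, h2, h3⟩ hq
  -- The fields of a basis of `𝔪_p` remain independent at `q`, and there are `dim 𝒱_p` of them;
  -- equal orbit dimension forces them to span.
  have hspan : Submodule.span ℝ (Set.range fun i => actionField E (X i) q) = vertical E F G q := by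
    refine Submodule.eq_of_le_of_finrank_eq ?_ ?_
    · rw [Submodule.span_le]
      rintro _ ⟨i, rfl⟩
      exact actionField_mem_vertical (X i) q
    · rw [finrank_span_eq_card h1, hq, Fintype.card_fin,
        (complementEquivVertical Q p).finrank_eq]
  refine (Submodule.eq_starProjection_of_mem_orthogonal ?_ ?_).symm
  · rw [horizontal, ← hspan, Submodule.mem_orthogonal]
    intro u hu
    induction hu using Submodule.span_induction with
    | mem x hx => obtain ⟨i, rfl⟩ := hx; exact h2 i
    | zero => simp
    | add x y _ _ hx hy => rw [inner_add_left, hx, hy, add_zero]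
    | smul a x _ hx => rw [inner_smul_left, hx, mul_zero]
  · exact Submodule.le_orthogonal_orthogonal _ (hspan ▸ h3)

/-- No regularity of `p` is needed: the vertical spaces have constant dimension along a single
orbit. -/
theorem exists_isNormalExtension (Q : BiinvariantMetric F G) {p : M}
    {v : TangentSpace 𝓘(ℝ, E) p} (hv : v ∈ horizontal E F G p) :
    ∃ V : Π q : M, TangentSpace 𝓘(ℝ, E) q, IsNormalExtension F G p v V := by
  obtain ⟨V, h1, h2, h3⟩ := exists_extension_eq_starProjection Q hv
  refine ⟨V, h1, h2, ?_⟩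
  filter_upwards [nhdsWithin_le_nhds h3, self_mem_nhdsWithin] with q hq hqo
  obtain ⟨a, rfl⟩ := hqo
  rw [hq (finrank_vertical_smul a p)]
  exact Submodule.starProjection_apply_mem _ _

/-- Only smoothness is at stake: near a regular point the projected field agrees with the smooth
field obtained by orthogonalisation. -/
theorem isHorizontalExtension_starProjection (Q : BiinvariantMetric F G) {p : M}
    (hp : IsRegularPoint E F G p) {v : TangentSpace 𝓘(ℝ, E) p} (hv : v ∈ horizontal E F G p) :
    IsHorizontalExtension F G p v
      (fun q => (horizontal E F G q).starProjection (extend E v q)) := by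
  obtain ⟨V, h1, h2, h3⟩ := exists_extension_eq_starProjection Q hv
  refine ⟨h1.congr_of_eventuallyEq ?_, ?_, .of_forall fun q =>
    Submodule.starProjection_apply_mem _ _⟩
  · filter_upwards [h3, hp] with q hq hq'
    rw [hq hq']
  · simp only [extend_apply_self]
    exact Submodule.starProjection_eq_self_iff.2 hv

end Action

/-! ### Mixed and horizontal pairs. -/

section Horizontal

variable {E : Type*} [NormedAddCommGroup E] [NormedSpace ℝ E] [FiniteDimensional ℝ E]
  {M : Type*} [TopologicalSpace M] [ChartedSpace E M] [IsManifold 𝓘(ℝ, E) ∞ M]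
  [RiemannianBundle (fun x : M => TangentSpace 𝓘(ℝ, E) x)]
  [IsContMDiffRiemannianBundle 𝓘(ℝ, E) ∞ E (fun x : M => TangentSpace 𝓘(ℝ, E) x)]
  {F : Type*} [NormedAddCommGroup F] [NormedSpace ℝ F] [FiniteDimensional ℝ F]
  {G : Type*} [TopologicalSpace G] [ChartedSpace F G] [Group G] [LieGroup 𝓘(ℝ, F) ∞ G]
  [MulAction G M] [ContMDiffSMul 𝓘(ℝ, F) 𝓘(ℝ, E) ∞ G M]
  {p : M}

theorem exists_actionField_eq_of_mem_isotropyComplement (Q : BiinvariantMetric F G)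
    {v : TangentSpace 𝓘(ℝ, E) p} (hv : v ∈ vertical E F G p) :
    ∃ X ∈ isotropyComplement E Q p, actionField E X p = v := by
  refine ⟨(complementEquivVertical Q p).symm ⟨v, hv⟩, Subtype.coe_prop _, ?_⟩
  exact congrArg Subtype.val ((complementEquivVertical Q p).apply_symm_apply ⟨v, hv⟩)

theorem inner_actionField_of_mem_horizontal {u : TangentSpace 𝓘(ℝ, E) p}
    (hu : u ∈ horizontal E F G p) (X : GroupLieAlgebra 𝓘(ℝ, F) G) :
    inner ℝ (actionField E X p) u = 0 :=
  hu _ (actionField_mem_vertical X p)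

/-- The second fundamental form of an orbit is symmetric. -/
theorem inner_leviCivita_actionField_comm (X Y : GroupLieAlgebra 𝓘(ℝ, F) G)
    {u : TangentSpace 𝓘(ℝ, E) p} (hu : u ∈ horizontal E F G p) :
    inner ℝ (leviCivita (fun q => actionField E Y q) p (actionField E X p)) u =
      inner ℝ (leviCivita (fun q => actionField E X q) p (actionField E Y p)) u := by
  have : CompleteSpace E := FiniteDimensional.complete ℝ E
  have : CompleteSpace F := FiniteDimensional.complete ℝ F
  have h := leviCivita_sub_leviCivita (mdiffAt_actionField (E := E) X p)
    (mdiffAt_actionField (E := E) Y p)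
  -- The two covariant derivatives differ by `-[X, Y]^*`, a vertical vector that pairs to zero with
  -- `u`.
  rw [mlieBracket_actionField] at h
  have h2 := congrArg (fun w => (inner ℝ w u : ℝ)) h
  simp only [inner_sub_left, inner_neg_left, inner_actionField_of_mem_horizontal hu] at h2
  linarith

/-- The curve `t ↦ c t • p` stays in the orbit and has velocity `X^*(p)`, so vanishing on the orbit
near `p` suffices. -/
theorem mvfderiv_actionField_eq_zero {f : M → ℝ} (hf : MDifferentiableAt 𝓘(ℝ, E) 𝓘(ℝ) f p)
    (h0 : ∀ᶠ q in 𝓝[MulAction.orbit G p] p, f q = 0) (X : GroupLieAlgebra 𝓘(ℝ, F) G) :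
    mvfderiv 𝓘(ℝ, E) f p (actionField E X p) = 0 := by
  obtain ⟨c, hc⟩ := exists_isCurveThroughOne X
  have hcp : MDifferentiableAt 𝓘(ℝ, ℝ) 𝓘(ℝ, E) (fun t => c t • p) 0 :=
    ((hc.contMDiffAt_smul p).comp (0 : ℝ)
      (contMDiffAt_id.prodMk contMDiffAt_const)).mdifferentiableAt (by simp)
  have hp : c 0 • p = p := by simp [hc.map_zero]
  have h1 := mvfderiv_comp_apply_of_eq (0 : ℝ) hf hcp hp (1 : ℝ)
  have h2 := congrArg (mvfderiv 𝓘(ℝ, E) f p : E → ℝ) (hc.mfderiv_smul p)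
  refine h2.symm.trans (h1.symm.trans ?_)
  rw [mvfderiv, mfderiv_eq_fderiv]
  have hlim : Filter.Tendsto (fun t => c t • p) (𝓝 0) (𝓝[MulAction.orbit G p] p) :=
    tendsto_nhdsWithin_iff.2 ⟨by simpa [ContinuousAt, hp] using hcp.continuousAt,
      .of_forall fun t => MulAction.mem_orbit p (c t)⟩
  have h3 : f ∘ (fun t => c t • p) =ᶠ[𝓝 0] fun _ => 0 := hlim.eventually h0
  rw [h3.fderiv_eq, fderiv_const_apply]
  rfl

theorem inner_leviCivita_actionField_eq_neg {V : Π q : M, TangentSpace 𝓘(ℝ, E) q}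
    {u : TangentSpace 𝓘(ℝ, E) p} (Z : GroupLieAlgebra 𝓘(ℝ, F) G) (hV : MDiffAt (T% V) p)
    (h0 : mvfderiv 𝓘(ℝ, E) (fun q => inner ℝ (actionField E Z q) (V q)) p u = 0) :
    inner ℝ (leviCivita (fun q => actionField E Z q) p u) (V p) =
      -inner ℝ (leviCivita V p u) (actionField E Z p) := by
  have hu := mdifferentiableAt_extend 𝓘(ℝ, E) E u
  have h := leviCivita_metric hu (mdiffAt_actionField (E := E) Z p) hV
  rw [extend_apply_self, h0, real_inner_comm (leviCivita V p u)] at h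
  linarith

theorem extDerivOneForm_dualForm_of_isNormalExtension (hiso : IsIsometricAction E M G)
    {V : Π q : M, TangentSpace 𝓘(ℝ, E) q} {u : TangentSpace 𝓘(ℝ, E) p}
    (hV : IsNormalExtension F G p u V) (X Z : GroupLieAlgebra 𝓘(ℝ, F) G) :
    extDerivOneForm (dualForm E M Z) p (actionField E X p) u =
      -inner ℝ (leviCivita V p (actionField E X p)) (actionField E Z p) := by
  obtain ⟨h1, rfl, h3⟩ := hV
  have hVd : MDiffAt (T% V) p := h1.mdifferentiableAt (by simp)
  rw [extDerivOneForm_dualForm hiso]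
  refine inner_leviCivita_actionField_eq_neg Z hVd (mvfderiv_actionField_eq_zero
    (mdiffAt_inner (mdiffAt_actionField Z p) hVd) ?_ X)
  filter_upwards [h3] with q hq using inner_actionField_of_mem_horizontal hq Z

theorem extDerivOneForm_dualForm_of_isHorizontalExtension (hiso : IsIsometricAction E M G)
    {V : Π q : M, TangentSpace 𝓘(ℝ, E) q} {v : TangentSpace 𝓘(ℝ, E) p}
    (hV : IsHorizontalExtension F G p v V) (u : TangentSpace 𝓘(ℝ, E) p)
    (Z : GroupLieAlgebra 𝓘(ℝ, F) G) :
    extDerivOneForm (dualForm E M Z) p u v =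
      -inner ℝ (leviCivita V p u) (actionField E Z p) := by
  obtain ⟨h1, rfl, h3⟩ := hV
  have hVd : MDiffAt (T% V) p := h1.mdifferentiableAt (by simp)
  rw [extDerivOneForm_dualForm hiso]
  refine inner_leviCivita_actionField_eq_neg Z hVd ?_
  have h4 : (fun q => (inner ℝ (actionField E Z q) (V q) : ℝ)) =ᶠ[𝓝 p] fun _ => 0 := by
    filter_upwards [h3] with q hq using inner_actionField_of_mem_horizontal hq Z
  rw [mvfderiv, h4.mfderiv_eq, mfderiv_const]
  rfl

/-- The shape operator is defined through fields from `𝔪_p`, while `Z` is arbitrary. By symmetry of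
the second fundamental form only `Z^*(p)` matters, so `Z` may be replaced by some `Y` in `𝔪_p` with
the same value at `p`. -/
theorem extDerivOneForm_dualForm_eq_inner_shapeOperator (hiso : IsIsometricAction E M G)
    (Q : BiinvariantMetric F G) {X : GroupLieAlgebra 𝓘(ℝ, F) G}
    (hX : X ∈ isotropyComplement E Q p) {u : TangentSpace 𝓘(ℝ, E) p}
    (hu : u ∈ horizontal E F G p) (Z : GroupLieAlgebra 𝓘(ℝ, F) G) :
    extDerivOneForm (dualForm E M Z) p (actionField E X p) u =
      inner ℝ (shapeOperator Q p u ⟨actionField E X p, actionField_mem_vertical X p⟩ :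
        TangentSpace 𝓘(ℝ, E) p) (actionField E Z p) := by
  obtain ⟨Y, hY, hYZ⟩ :=
    exists_actionField_eq_of_mem_isotropyComplement Q (actionField_mem_vertical (E := E) Z p)
  rw [extDerivOneForm_dualForm hiso, inner_leviCivita_actionField_comm X Z hu, ← hYZ,
    ← inner_leviCivita_actionField_comm X Y hu]
  exact (inner_shapeOperator Q p u ⟨X, hX⟩ ⟨Y, hY⟩).symm

/-- Expand the derivative of `g(X^*, Z^*)` along `u`. The Killing equation turns its two terms into
`-g(∇_{Z^*} X^*, u)` and `-g(∇_{X^*} Z^*, u)`, which agree by symmetry of the second fundamental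
form. -/
theorem two_mul_extDerivOneForm_dualForm_eq_neg_mvfderiv (hiso : IsIsometricAction E M G)
    (Q : BiinvariantMetric F G) (X Z : GroupLieAlgebra 𝓘(ℝ, F) G) {u : TangentSpace 𝓘(ℝ, E) p}
    (hu : u ∈ horizontal E F G p) :
    2 * extDerivOneForm (dualForm E M Z) p (actionField E X p) u =
      -mvfderiv 𝓘(ℝ, E) (fun q : M => Q.form (orbitTensorExt E Q q X) Z) p u := by
  simp only [form_orbitTensorExt]
  have h := leviCivita_metric (mdifferentiableAt_extend 𝓘(ℝ, E) E u)
    (mdiffAt_actionField (E := E) X p) (mdiffAt_actionField (E := E) Z p)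
  rw [extend_apply_self] at h
  rw [h, extDerivOneForm_dualForm hiso, real_inner_comm _ (actionField E X p),
    inner_leviCivita_actionField_skew hiso X p u, inner_leviCivita_actionField_skew hiso Z p u,
    inner_leviCivita_actionField_comm X Z hu]
  ring

/-- The vertical projection in the O'Neill tensor is invisible when paired with the vertical vector
`Z^*`. -/
theorem extDerivOneForm_dualForm_eq_inner_oneillTensor (hiso : IsIsometricAction E M G)
    (Q : BiinvariantMetric F G) (hp : IsRegularPoint E F G p) (u : TangentSpace 𝓘(ℝ, E) p)
    {v : TangentSpace 𝓘(ℝ, E) p} (hv : v ∈ horizontal E F G p)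
    (Z : GroupLieAlgebra 𝓘(ℝ, F) G) :
    extDerivOneForm (dualForm E M Z) p u v =
      -inner ℝ (oneillTensor F G p u v) (actionField E Z p) := by
  rw [extDerivOneForm_dualForm_of_isHorizontalExtension hiso
    (isHorizontalExtension_starProjection Q hp hv), oneillTensor,
    Submodule.inner_starProjection_left_eq_right,
    Submodule.starProjection_eq_self_iff.2 (actionField_mem_vertical Z p)]

/-- The linear map `X ↦ ∇_u X^*`. -/
def leviCivitaActionField (p : M) (u : TangentSpace 𝓘(ℝ, E) p) :
    GroupLieAlgebra 𝓘(ℝ, F) G →ₗ[ℝ] TangentSpace 𝓘(ℝ, E) p where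
  toFun X := leviCivita (fun q => actionField E X q) p u
  map_add' X Y := by
    have h : (fun q : M => actionField E (X + Y) q) =
        (fun q => actionField E X q) + (fun q => actionField E Y q) := by
      funext q
      simp [actionField]
    rw [h, leviCivita.isCovariantDerivativeOnUniv.add (mdiffAt_actionField _ p)
      (mdiffAt_actionField _ p), _root_.add_apply]
  map_smul' c X := by
    have h : (fun q : M => actionField E (c • X) q) = c • (fun q => actionField E X q) := by
      funext q
      simp [actionField]
    rw [h, leviCivita.isCovariantDerivativeOnUniv.smul_const c (mdiffAt_actionField _ p),
      _root_.smul_apply, RingHom.id_apply]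

/-- Riesz representation on `𝒱_p`: the prescribed values are linear in `X`, being `-g(∇_u X^*, v)`,
and `𝔪_p ≃ 𝒱_p` makes them a functional on the vertical space. -/
theorem existsUnique_vertical_inner_actionField (hiso : IsIsometricAction E M G)
    (Q : BiinvariantMetric F G) (p : M) (u v : TangentSpace 𝓘(ℝ, E) p) :
    ∃! A : TangentSpace 𝓘(ℝ, E) p, A ∈ vertical E F G p ∧ ∀ X ∈ isotropyComplement E Q p,
      inner ℝ A (actionField E X p) = -extDerivOneForm (dualForm E M X) p u v := by
  let l : vertical E F G p →ₗ[ℝ] ℝ :=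
    -((innerₗ (TangentSpace 𝓘(ℝ, E) p) v) ∘ₗ leviCivitaActionField p u ∘ₗ
      (isotropyComplement E Q p).subtype ∘ₗ (complementEquivVertical Q p).symm.toLinearMap)
  let A : vertical E F G p :=
    (InnerProductSpace.toDual ℝ (vertical E F G p)).symm (LinearMap.toContinuousLinearMap l)
  have hA : ∀ X ∈ isotropyComplement E Q p,
      inner ℝ (A : TangentSpace 𝓘(ℝ, E) p) (actionField E X p) =
        -extDerivOneForm (dualForm E M X) p u v := fun X hX => by
    have h1 : (inner ℝ A (complementEquivVertical Q p ⟨X, hX⟩) : ℝ) =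
        l (complementEquivVertical Q p ⟨X, hX⟩) :=
      InnerProductSpace.toDual_symm_apply
    refine h1.trans ?_
    rw [extDerivOneForm_dualForm hiso, real_inner_comm]
    simp only [l, LinearMap.neg_apply, LinearMap.comp_apply, LinearEquiv.coe_coe,
      LinearEquiv.symm_apply_apply]
    rfl
  refine ⟨A, ⟨A.2, hA⟩, fun B hB => ?_⟩
  -- The difference of two solutions is itself `X^*(p)` for some `X` in `𝔪_p`; testing with this `X`
  -- shows that its norm is zero.
  obtain ⟨X, hX, hXB⟩ := exists_actionField_eq_of_mem_isotropyComplement Q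
    (Submodule.sub_mem _ hB.1 A.2)
  have h := (hB.2 X hX).trans (hA X hX).symm
  rw [hXB, ← sub_eq_zero, ← inner_sub_left, inner_self_eq_zero, sub_eq_zero] at h
  exact h

end Horizontal

end Cheeger
end

open Cheeger
theorem proposition1p5
    -- the Riemannian manifold `(M, g)`
    {E : Type*} [NormedAddCommGroup E] [NormedSpace ℝ E] [FiniteDimensional ℝ E]
    {M : Type*} [TopologicalSpace M] [ChartedSpace E M] [IsManifold 𝓘(ℝ, E) ∞ M]
    [RiemannianBundle (fun x : M => TangentSpace 𝓘(ℝ, E) x)]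
    [IsContMDiffRiemannianBundle 𝓘(ℝ, E) ∞ E (fun x : M => TangentSpace 𝓘(ℝ, E) x)]
    -- the compact Lie group `G`, acting smoothly and isometrically on `M`
    {F : Type*} [NormedAddCommGroup F] [NormedSpace ℝ F] [FiniteDimensional ℝ F]
    {G : Type*} [TopologicalSpace G] [ChartedSpace F G] [Group G] [LieGroup 𝓘(ℝ, F) ∞ G]
    [CompactSpace G] [MulAction G M] [ContMDiffSMul 𝓘(ℝ, F) 𝓘(ℝ, E) ∞ G M]
    (hiso : IsIsometricAction E M G)
    (Q : BiinvariantMetric F G) (Z : GroupLieAlgebra 𝓘(ℝ, F) G) (p : M) :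
    -- (a) two vertical vectors
    (∀ X ∈ isotropyComplement E Q p, ∀ Y ∈ isotropyComplement E Q p,
      2 * extDerivOneForm (dualForm E M Z) p (actionField E X p) (actionField E Y p) =
        Q.form (⁅orbitTensorExt E Q p X, Y⁆ + ⁅X, orbitTensorExt E Q p Y⁆
          - orbitTensorExt E Q p ⁅X, Y⁆) Z) ∧
    -- (b) a vertical and a horizontal vector
    (∀ X ∈ isotropyComplement E Q p, ∀ U ∈ horizontal E F G p,
      (∃ V : Π q : M, TangentSpace 𝓘(ℝ, E) q, IsNormalExtension F G p U V) ∧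
      (∀ V : Π q : M, TangentSpace 𝓘(ℝ, E) q, IsNormalExtension F G p U V →
        2 * extDerivOneForm (dualForm E M Z) p (actionField E X p) U =
          -2 * inner ℝ (leviCivita V p (actionField E X p)) (actionField E Z p)) ∧
      2 * extDerivOneForm (dualForm E M Z) p (actionField E X p) U =
        2 * inner ℝ (shapeOperator Q p U ⟨actionField E X p, actionField_mem_vertical X p⟩ :
          TangentSpace 𝓘(ℝ, E) p) (actionField E Z p) ∧
      2 * extDerivOneForm (dualForm E M Z) p (actionField E X p) U =
        -mvfderiv 𝓘(ℝ, E) (fun q : M => Q.form (orbitTensorExt E Q q X) Z) p U) ∧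
    -- (c) two horizontal vectors
    (∀ U ∈ horizontal E F G p, ∀ V ∈ horizontal E F G p,
      (∀ W : Π q : M, TangentSpace 𝓘(ℝ, E) q, IsHorizontalExtension F G p V W →
        extDerivOneForm (dualForm E M Z) p U V =
          -inner ℝ (leviCivita W p U) (actionField E Z p)) ∧
      (IsRegularPoint E F G p →
        (∃ W : Π q : M, TangentSpace 𝓘(ℝ, E) q, IsHorizontalExtension F G p V W) ∧
        extDerivOneForm (dualForm E M Z) p U V =
          -inner ℝ (oneillTensor F G p U V) (actionField E Z p)) ∧
      (∃! A : TangentSpace 𝓘(ℝ, E) p, A ∈ vertical E F G p ∧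
        ∀ X ∈ isotropyComplement E Q p,
          inner ℝ A (actionField E X p) = -extDerivOneForm (dualForm E M X) p U V)) := by
  refine ⟨fun X _ Y _ => two_mul_extDerivOneForm_dualForm_vertical hiso Q p X Y Z,
    fun X hX U hU => ⟨exists_isNormalExtension Q hU, fun V hV => ?_, ?_,
      two_mul_extDerivOneForm_dualForm_eq_neg_mvfderiv hiso Q X Z hU⟩,
    fun U _ V hV => ⟨fun W hW => extDerivOneForm_dualForm_of_isHorizontalExtension hiso hW U Z,
      fun hp => ⟨⟨_, isHorizontalExtension_starProjection Q hp hV⟩,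
        extDerivOneForm_dualForm_eq_inner_oneillTensor hiso Q hp U hV Z⟩,
      existsUnique_vertical_inner_actionField hiso Q p U V⟩⟩
  · rw [extDerivOneForm_dualForm_of_isNormalExtension hiso hV]
    ring
  · rw [extDerivOneForm_dualForm_eq_inner_shapeOperator hiso Q hX hU]
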